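/- Let $m\ge 2$ be an integer, let $S^m$ be the unit sphere of $\mathbb R^{m+1}$ with its surface measure $\sigma_m$, and put $\delta=2$ if $m=2$ and $\delta=1$ if $m\ge 3$. A kernel $K:S^m\times S^m\to\mathbb C$ in $L^2(S^m\times S^m)$ generates the integral operator $\mathcal K f=\int_{S^m}K(\cdot,y)f(y)\,d\sigma_m(y)$ on the complex Hilbert space $L^2(S^m)$; $K$ is called $L^2$-positive definite if $\mathcal K$ is a positive operator. For $-1<t<1$ let $S_tf(x)$ be the mean of $f$ over $\{y\in S^m: x\cdot y=t\}$ with respect to its surface measure. The Laplace–Beltrami derivative of $f\in L^2(S^m)$ is the function $\mathcal Df\in L^2(S^m)$, if it exists, with $\big\|\frac{f-S_tf}{1-t}-\mathcal Df\big\|_2\to0$ as $t\to1^-$; put $\mathcal D^r=\mathcal D\circ\mathcal D^{r-1}$, and let $W_2^\infty$ be the set of $f\in L^2(S^m)$ for which $\mathcal D^rf$ exists for all $r\ge1$. A kernel $K$ belongs to $W_2^\infty$ if $K(x,\cdot)\in W_2^\infty$ for almost every $x$; then $K_{0,r}:=\mathcal D^r_yK$ is its derivative of order $r$ in the second variable and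 $\mathcal K_{0,r}$ is the integral operator generated by $K_{0,r}$. Let $d_n^m$ be the dimension of the space of spherical harmonics of degree $n$ in $m+1$ variables, and let $P_n^m$ be the Legendre polynomial of degree $n$ associated with $m$ (the Gegenbauer polynomial of index $(m-1)/2$, normalized by $P_n^m(1)=1$). **Theorem.** There exist a sequence $(\beta_n)_{n\ge1}$ of positive real numbers with $\beta_n=O(n^{1/m})$ as $n\to\infty$ and an $L^2$-positive definite kernel $K$ that belongs to $W_2^\infty$, with $\mathcal K_{0,r}$ bounded on $L^2(S^m)$ for every $r$, such that $$\sum_{n=1}^\infty n^{\frac{n^{1/m}}{\delta m}+\beta_n}\,\lambda_n(\mathcal K)$$ diverges, where $\lambda_1(\mathcal K)\ge\lambda_2(\mathcal K)\ge\dots\ge0$ are the eigenvalues of $\mathcal K$ in non-increasing order, repeated according to multiplicity. Moreover, one can take for $K$ the kernel $$K(x,y)=1+\sum_{n=1}^\infty\frac{d_n^m}{n^{2n+m-1}}\,P_n^m(x\cdot y),\qquad x,y\in S^m.$$ -/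

import Mathlib

open MeasureTheory Filter Topology Asymptotics

namespace SphericalKernels

/-- The unit sphere `S^m` of the Euclidean space `ℝ^(m+1)`. -/
abbrev Sph (m : ℕ) : Type := Metric.sphere (0 : EuclideanSpace ℝ (Fin (m + 1))) 1

/-- The surface measure `σ_m` on `S^m` induced by Lebesgue measure on `ℝ^(m+1)`. -/
noncomputable def surf (m : ℕ) : Measure (Sph m) :=
  (volume : Measure (EuclideanSpace ℝ (Fin (m + 1)))).toSphere

/-- The complex Hilbert space `L²(S^m) = L²(S^m, σ_m)`. -/
abbrev L2Sph (m : ℕ) : Type := Lp ℂ 2 (surf m)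

/-! ### Spherical shifting and Laplace-Beltrami derivatives -/

/-- The unit sphere of the hyperplane orthogonal to `x`. -/
abbrev Equator {m : ℕ} (x : Sph m) : Type :=
  Metric.sphere (0 : (ℝ ∙ (x : EuclideanSpace ℝ (Fin (m + 1))))ᗮ) 1

/-- The surface measure on the unit sphere of the hyperplane orthogonal to `x`, induced by
Lebesgue measure of that hyperplane. -/
noncomputable def equatorMeasure {m : ℕ} (x : Sph m) : Measure (Equator x) :=
  (volume : Measure (ℝ ∙ (x : EuclideanSpace ℝ (Fin (m + 1))))ᗮ).toSphere

theorem norm_cos_smul_add_sin_smul {m : ℕ} (x : Sph m) (u : Equator x) (θ : ℝ) :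
    ‖Real.cos θ • (x : EuclideanSpace ℝ (Fin (m + 1))) +
      Real.sin θ • ((u : (ℝ ∙ (x : EuclideanSpace ℝ (Fin (m + 1))))ᗮ) :
        EuclideanSpace ℝ (Fin (m + 1)))‖ = 1 := by
  have hx : ‖(x : EuclideanSpace ℝ (Fin (m + 1)))‖ = 1 := norm_eq_of_mem_sphere x
  have hu : ‖((u : (ℝ ∙ (x : EuclideanSpace ℝ (Fin (m + 1))))ᗮ) :
      EuclideanSpace ℝ (Fin (m + 1)))‖ = 1 := norm_eq_of_mem_sphere u
  have hxu : inner ℝ (x : EuclideanSpace ℝ (Fin (m + 1)))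
      ((u : (ℝ ∙ (x : EuclideanSpace ℝ (Fin (m + 1))))ᗮ) :
        EuclideanSpace ℝ (Fin (m + 1))) = 0 :=
    Submodule.mem_orthogonal_singleton_iff_inner_right.1 (u : (ℝ ∙ (x : EuclideanSpace ℝ (Fin (m + 1))))ᗮ).2
  have h : ‖Real.cos θ • (x : EuclideanSpace ℝ (Fin (m + 1))) +
      Real.sin θ • ((u : (ℝ ∙ (x : EuclideanSpace ℝ (Fin (m + 1))))ᗮ) :
        EuclideanSpace ℝ (Fin (m + 1)))‖ ^ 2 = 1 := by
    rw [norm_add_sq_real, norm_smul, norm_smul, hx, hu, inner_smul_left, inner_smul_right, hxu]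
    simp
  nlinarith [norm_nonneg (Real.cos θ • (x : EuclideanSpace ℝ (Fin (m + 1))) +
      Real.sin θ • ((u : (ℝ ∙ (x : EuclideanSpace ℝ (Fin (m + 1))))ᗮ) :
        EuclideanSpace ℝ (Fin (m + 1))))]

/-- For `-1 ≤ t ≤ 1` this is the point `t x + √(1 - t²) u`; as `u` runs through the unit sphere of
the hyperplane orthogonal to `x`, it runs through the rim `{y ∈ S^m : x · y = t}`. -/
noncomputable def rimPoint {m : ℕ} (x : Sph m) (t : ℝ) (u : Equator x) : Sph m :=
  ⟨Real.cos (Real.arccos t) • (x : EuclideanSpace ℝ (Fin (m + 1))) +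
      Real.sin (Real.arccos t) • ((u : (ℝ ∙ (x : EuclideanSpace ℝ (Fin (m + 1))))ᗮ) :
        EuclideanSpace ℝ (Fin (m + 1))),
    mem_sphere_zero_iff_norm.2 (norm_cos_smul_add_sin_smul x u (Real.arccos t))⟩

theorem rimPoint_coe {m : ℕ} (x : Sph m) (t : ℝ) (ht₁ : -1 ≤ t) (ht₂ : t ≤ 1) (u : Equator x) :
    (rimPoint x t u : EuclideanSpace ℝ (Fin (m + 1))) =
      t • (x : EuclideanSpace ℝ (Fin (m + 1))) +
        √(1 - t ^ 2) • ((u : (ℝ ∙ (x : EuclideanSpace ℝ (Fin (m + 1))))ᗮ) :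
          EuclideanSpace ℝ (Fin (m + 1))) := by
  simp only [rimPoint, Real.cos_arccos ht₁ ht₂, Real.sin_arccos]

/-- Spherical shifting: `S_t f (x)` is the mean value of `f` over the rim `{y : x · y = t}` with
respect to the surface measure of the rim. The rim is a sphere of radius `√(1 - t²)` in a
hyperplane orthogonal to `x`, so its normalised surface measure is the image of the normalised
surface measure of the unit sphere of `xᗮ`. -/
noncomputable def shift {m : ℕ} (t : ℝ) (f : Sph m → ℂ) (x : Sph m) : ℂ :=
  ⨍ u, f (rimPoint x t u) ∂(equatorMeasure x)

/-- `g` is the Laplace-Beltrami derivative of `f`: both are in `L²(S^m)`, and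
`(f - S_t f) / (1 - t) → g` in `L²(S^m)` as `t → 1⁻`. -/
def IsLBDeriv {m : ℕ} (f g : Sph m → ℂ) : Prop :=
  MemLp f 2 (surf m) ∧ MemLp g 2 (surf m) ∧
    Tendsto (fun t : ℝ =>
      eLpNorm (fun x => (f x - shift t f x) / ((1 - t : ℝ) : ℂ) - g x) 2 (surf m))
      (𝓝[<] 1) (𝓝 0)

/-- `g` is the Laplace-Beltrami derivative of order `r` of `f` (of order `0`: `f` itself). -/
def IsLBDerivOfOrder {m : ℕ} : ℕ → (Sph m → ℂ) → (Sph m → ℂ) → Prop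
  | 0, f, g => MemLp f 2 (surf m) ∧ g =ᵐ[surf m] f
  | r + 1, f, g => ∃ h, IsLBDerivOfOrder r f h ∧ IsLBDeriv h g

/-- `f` belongs to `W_2^∞`: it has Laplace-Beltrami derivatives of all orders. -/
def MemWInfty {m : ℕ} (f : Sph m → ℂ) : Prop :=
  ∀ r : ℕ, ∃ g, IsLBDerivOfOrder r f g

/-! ### Kernels and integral operators -/

/-- The bounded operator `T` on `L²(S^m)` is the integral operator `f ↦ ∫ K(·, y) f(y) dσ_m(y)`
generated by the kernel `K`. -/
def IsIntegralOperator {m : ℕ} (K : Sph m → Sph m → ℂ) (T : L2Sph m →L[ℂ] L2Sph m) : Prop :=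
  ∀ f : L2Sph m, ∀ᵐ x ∂(surf m),
    Integrable (fun y => K x y * f y) (surf m) ∧ T f x = ∫ y, K x y * f y ∂(surf m)

/-- `K ∈ L²(S^m × S^m)`. -/
def KernelMemL2 {m : ℕ} (K : Sph m → Sph m → ℂ) : Prop :=
  MemLp (fun p : Sph m × Sph m => K p.1 p.2) 2 ((surf m).prod (surf m))

/-- `K` is `L²`-positive definite: it is a square integrable kernel and the integral operator it
generates is positive. -/
def IsL2PD {m : ℕ} (K : Sph m → Sph m → ℂ) : Prop :=
  KernelMemL2 K ∧ ∃ T : L2Sph m →L[ℂ] L2Sph m, IsIntegralOperator K T ∧ T.IsPositive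

/-- `K` belongs to `W_2^∞`: for almost every `x`, the function `K(x, ·)` does. -/
def KernelMemWInfty {m : ℕ} (K : Sph m → Sph m → ℂ) : Prop :=
  ∀ᵐ x ∂(surf m), MemWInfty (K x)

/-- `L` is the kernel `K_{0,r} = 𝒟_y^r K`, the Laplace-Beltrami derivative of order `r` of `K` with
respect to the second variable. -/
def IsKernelLBDeriv {m : ℕ} (r : ℕ) (K L : Sph m → Sph m → ℂ) : Prop :=
  AEStronglyMeasurable (fun p : Sph m × Sph m => L p.1 p.2) ((surf m).prod (surf m)) ∧
    ∀ᵐ x ∂(surf m), IsLBDerivOfOrder r (K x) (L x)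

/-- The standing assumptions on the kernel: `K` is `L²`-positive definite, it belongs to `W_2^∞`,
and for every order `r` the integral operator generated by `K_{0,r}` is bounded on `L²(S^m)`. -/
structure IsSmoothPDKernel {m : ℕ} (K : Sph m → Sph m → ℂ) : Prop where
  l2pd : IsL2PD K
  smooth : KernelMemWInfty K
  bounded : ∀ r : ℕ, ∃ L : Sph m → Sph m → ℂ, IsKernelLBDeriv r K L ∧
    ∃ T : L2Sph m →L[ℂ] L2Sph m, IsIntegralOperator L T

/-- `lam 1 ≥ lam 2 ≥ ⋯ ≥ 0` is the list of the eigenvalues of the (positive, compact) operator `T`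
in non-increasing order, every nonzero eigenvalue being repeated according to its multiplicity. -/
structure IsEigenvalueSequence {m : ℕ} (T : L2Sph m →L[ℂ] L2Sph m) (lam : ℕ+ → ℝ) : Prop where
  antitone : Antitone lam
  nonneg : ∀ n, 0 ≤ lam n
  finite_mult : ∀ μ : ℝ, 0 < μ →
    FiniteDimensional ℂ (Module.End.eigenspace (T : L2Sph m →ₗ[ℂ] L2Sph m) (μ : ℂ))
  count : ∀ μ : ℝ, 0 < μ → {n : ℕ+ | lam n = μ}.encard =
    (Module.finrank ℂ (Module.End.eigenspace (T : L2Sph m →ₗ[ℂ] L2Sph m) (μ : ℂ)) : ℕ∞)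

/-! ### Spherical harmonics and Legendre polynomials -/

/-- Restriction to `S^m` of a complex polynomial in `m + 1` variables. -/
noncomputable def restrictSph (m : ℕ) : MvPolynomial (Fin (m + 1)) ℂ →ₗ[ℂ] (Sph m → ℂ) where
  toFun p := fun x =>
    MvPolynomial.eval (fun i => (((x : EuclideanSpace ℝ (Fin (m + 1))) i : ℝ) : ℂ)) p
  map_add' p q := by ext x; simp
  map_smul' c p := by ext x; simp [MvPolynomial.smul_eval]

/-- The Laplacian `∑ᵢ ∂ᵢ²` on polynomials in `m + 1` variables. -/
noncomputable def polyLaplacian (m : ℕ) :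
    MvPolynomial (Fin (m + 1)) ℂ →ₗ[ℂ] MvPolynomial (Fin (m + 1)) ℂ :=
  ∑ i : Fin (m + 1), (MvPolynomial.pderiv i).toLinearMap ∘ₗ (MvPolynomial.pderiv i).toLinearMap

/-- The space `ℋ_n^{m+1}` of spherical harmonics of degree `n` in `m + 1` variables: restrictions
to `S^m` of harmonic homogeneous polynomials of degree `n`. -/
noncomputable def sphericalHarmonics (m n : ℕ) : Submodule ℂ (Sph m → ℂ) :=
  (MvPolynomial.homogeneousSubmodule (Fin (m + 1)) ℂ n ⊓ LinearMap.ker (polyLaplacian m)).map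
    (restrictSph m)

/-- `d_n^m = dim ℋ_n^{m+1}`. -/
noncomputable def dimHarm (m n : ℕ) : ℕ := Module.finrank ℂ (sphericalHarmonics m n)

/-- The Legendre polynomial `P_n^m` of degree `n` associated with `m` (the Gegenbauer polynomial
of index `(m - 1) / 2` normalised by `P_n^m(1) = 1`), through its three-term recurrence
`(n + m) P_{n+2} = (2 n + m + 1) t P_{n+1} - (n + 1) P_n`. -/
noncomputable def legendreP (m : ℕ) : ℕ → ℝ → ℝ
  | 0, _ => 1
  | 1, t => t
  | n + 2, t => ((2 * n + m + 1) * t * legendreP m (n + 1) t - (n + 1) * legendreP m n t) / (n + m)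

/-- `δ = 2` if `m = 2`, and `δ = 1` if `m ≥ 3`. -/
noncomputable def delta (m : ℕ) : ℝ := if m = 2 then 2 else 1

end SphericalKernels

open SphericalKernels

/-!
The kernel `K(x, y) = 1 + ∑ₙ d_n n^{-(2n+m-1)} P_n(x · y)` is diagonalised by spherical harmonics:
the integral operator it generates is multiplication by `|S^m| / n^{2n+m-1}` on the harmonics of
degree `n`. Since there are at least `(n / m)^m` eigenvalues of degree less than `n`, the `k`-th
eigenvalue has degree at most `m k^{1/m}`, hence is at least `|S^m| k^{-C k^{1/m}}` for
`k ≥ m`, with `C = 2m(m+1)`. For `β_k = C k^{1/m}` the terms of the series stay above `|S^m|`.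

The theory of spherical harmonics behind this rests on two devices.

* Polynomials are integrated against the weight `exp (-|v|²/2)`, over `ℝ^(m+1)` and over the
  hyperplanes `yᗮ`. In polar coordinates such an integral is a positive multiple of the integral
  over the unit sphere (`gaussInt_eq_radialFactor_mul`), while integration by parts exchanges
  `w · v` with the derivative in the direction `w` (`gaussInt_dirDeriv`). This gives the
  orthogonality of harmonics of different degrees (`sphInt_mul_eq_zero`).
* The zonal polynomials `Z_n(w, y) = |y|ⁿ P_n(w · y / |y|)` satisfy `∂_w Z_{n+1} = (n + 1) Z_n` for
  `|w| = 1` (`dirDeriv_zonal`), so that the recurrence of the Legendre polynomials shows that they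
  are harmonic. With Euler's relation `∂_w Y(w) = n Y(w)` the same recurrence shows, by induction on
  the degree, that `Z_n` reproduces the harmonics of degree `n` up to a constant; a trace
  determines the constant (`sphInt_zonal_mul`).

Spherical means are computed from the fact that a harmonic `Y` with `Y(y) = 0` has integral zero over
every rim centred at `y`: on `yᗮ` Green's formula trades `n Y` for `-∂_y² Y`, which has lower degree
and also vanishes at `y` (`sphereInt_hyperplane_eq_zero`). Applied to `Y - Y(y) Z_n(y, ·)` it yields
`S_t Y = P_n(t) Y` (`shift_restrictSph`). The coefficients of `K` decay faster than any geometric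
sequence, so crude exponential bounds on `P_n` and on `(1 - P_n(t)) / (1 - t)` allow the
Laplace-Beltrami derivative to be taken term by term (`isLBDeriv_zonalKernel`).

Completeness follows from Stone-Weierstrass, because multiplication by a coordinate maps harmonics
of degree `n` into the sum of those of degrees `n + 1` and `n - 1` (`restrictSph_X_mul_mem`); the same
fact gives the lower bound for the number of eigenvalues (`pow_le_cumDim`).
-/

namespace SphericalKernels

open MvPolynomial

/-! ### Polynomials in several variables and their derivatives -/

/-- The ambient Euclidean space `ℝ^(m+1)`. -/
abbrev Amb (m : ℕ) : Type := EuclideanSpace ℝ (Fin (m + 1))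

/-- Complex polynomials in `m + 1` variables. -/
abbrev Poly (m : ℕ) : Type := MvPolynomial (Fin (m + 1)) ℂ

/-- The value of a complex polynomial at a real point. -/
noncomputable def evalAt {m : ℕ} (x : Amb m) : Poly m →+* ℂ := eval (fun i => ((x i : ℝ) : ℂ))

/-- The derivative of polynomials in the direction `w`. -/
noncomputable def dirDeriv {m : ℕ} (w : Amb m) : Derivation ℂ (Poly m) (Poly m) :=
  mkDerivation ℂ (fun i => C ((w i : ℝ) : ℂ))

/-- The linear form `y ↦ w · y`. -/
noncomputable def linForm {m : ℕ} (w : Amb m) : Poly m := ∑ i, C ((w i : ℝ) : ℂ) * X i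

/-- The polynomial `|y|²`. -/
noncomputable def sqNorm (m : ℕ) : Poly m := ∑ i, X i * X i

/-- Harmonic homogeneous polynomials of degree `n`. -/
noncomputable def harmPoly (m n : ℕ) : Submodule ℂ (Poly m) :=
  homogeneousSubmodule (Fin (m + 1)) ℂ n ⊓ LinearMap.ker (polyLaplacian m)

variable {m : ℕ}

theorem mem_harmPoly {n : ℕ} {p : Poly m} :
    p ∈ harmPoly m n ↔ p.IsHomogeneous n ∧ polyLaplacian m p = 0 := by
  simp [harmPoly, mem_homogeneousSubmodule]

/-! ### Directional derivatives and the Laplacian of polynomials -/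

/-- Derivations with constant coefficients commute, because their commutator is a derivation that
kills the variables. -/
theorem derivation_comm_of_const (D₁ D₂ : Derivation ℂ (Poly m) (Poly m))
    (h₁ : ∀ i, ∃ c, D₁ (X i) = C c) (h₂ : ∀ i, ∃ c, D₂ (X i) = C c) (p : Poly m) :
    D₁ (D₂ p) = D₂ (D₁ p) := by
  have h : ⁅D₁, D₂⁆ = 0 := by
    refine MvPolynomial.derivation_ext fun i => ?_
    obtain ⟨a, ha⟩ := h₁ i
    obtain ⟨b, hb⟩ := h₂ i
    rw [Derivation.commutator_apply, ha, hb]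
    simp
  have := congrArg (fun D : Derivation ℂ (Poly m) (Poly m) => D p) h
  simpa [Derivation.commutator_apply, sub_eq_zero] using this

theorem dirDeriv_X (w : Amb m) (i : Fin (m + 1)) : dirDeriv w (X i) = C ((w i : ℝ) : ℂ) := by
  simp [dirDeriv]

theorem pderiv_X_const (i j : Fin (m + 1)) : ∃ c, pderiv i (X j : Poly m) = C c := by
  classical
  rw [pderiv_X]
  refine ⟨if i = j then 1 else 0, ?_⟩
  by_cases h : i = j
  · subst h; simp
  · simp [h, Ne.symm h]

theorem dirDeriv_pderiv (w : Amb m) (i : Fin (m + 1)) (p : Poly m) :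
    dirDeriv w (pderiv i p) = pderiv i (dirDeriv w p) :=
  derivation_comm_of_const _ _ (fun j => ⟨_, dirDeriv_X w j⟩) (pderiv_X_const i) p

theorem dirDeriv_apply (w : Amb m) (p : Poly m) :
    dirDeriv w p = ∑ i, C ((w i : ℝ) : ℂ) * pderiv i p := by
  have hsum : ∀ q : Poly m, (∑ i, ((w i : ℝ) : ℂ) • (pderiv i : Derivation ℂ (Poly m) (Poly m))) q =
      ∑ i, C ((w i : ℝ) : ℂ) * pderiv i q := by
    intro q
    rw [← Derivation.coeFnAddMonoidHom_apply, map_sum, Finset.sum_apply]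
    simp [smul_eq_C_mul]
  have h : dirDeriv w = ∑ i, ((w i : ℝ) : ℂ) • (pderiv i : Derivation ℂ (Poly m) (Poly m)) := by
    refine MvPolynomial.derivation_ext fun j => ?_
    rw [dirDeriv_X, hsum, Finset.sum_eq_single j]
    · simp
    · intro i _ hi
      simp [pderiv_X_of_ne hi.symm]
    · simp
  rw [h, hsum]

theorem polyLaplacian_apply (p : Poly m) : polyLaplacian m p = ∑ i, pderiv i (pderiv i p) := by
  simp [polyLaplacian]

theorem polyLaplacian_dirDeriv (w : Amb m) (p : Poly m) :
    polyLaplacian m (dirDeriv w p) = dirDeriv w (polyLaplacian m p) := by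
  simp only [polyLaplacian_apply, map_sum, dirDeriv_pderiv]

theorem polyLaplacian_pderiv (i : Fin (m + 1)) (p : Poly m) :
    polyLaplacian m (pderiv i p) = pderiv i (polyLaplacian m p) := by
  simp only [polyLaplacian_apply, map_sum]
  refine Finset.sum_congr rfl fun j _ => ?_
  rw [derivation_comm_of_const (pderiv i) (pderiv j) (pderiv_X_const i) (pderiv_X_const j),
    derivation_comm_of_const (pderiv i) (pderiv j) (pderiv_X_const i) (pderiv_X_const j)]

theorem isHomogeneous_dirDeriv {n : ℕ} {p : Poly m} (hp : p.IsHomogeneous n) (w : Amb m) :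
    (dirDeriv w p).IsHomogeneous (n - 1) := by
  rw [dirDeriv_apply]
  refine IsHomogeneous.sum _ _ _ fun i _ => ?_
  simpa using (isHomogeneous_C (Fin (m + 1)) ((w i : ℝ) : ℂ)).mul (hp.pderiv (i := i))

theorem dirDeriv_mem_harmPoly {n : ℕ} {p : Poly m} (hp : p ∈ harmPoly m n) (w : Amb m) :
    dirDeriv w p ∈ harmPoly m (n - 1) := by
  rw [mem_harmPoly] at hp ⊢
  exact ⟨isHomogeneous_dirDeriv hp.1 w, by rw [polyLaplacian_dirDeriv, hp.2, map_zero]⟩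

theorem pderiv_mem_harmPoly {n : ℕ} {p : Poly m} (hp : p ∈ harmPoly m n) (i : Fin (m + 1)) :
    pderiv i p ∈ harmPoly m (n - 1) := by
  rw [mem_harmPoly] at hp ⊢
  exact ⟨hp.1.pderiv, by rw [polyLaplacian_pderiv, hp.2, map_zero]⟩

theorem polyLaplacian_mul (p q : Poly m) :
    polyLaplacian m (p * q) =
      p * polyLaplacian m q + q * polyLaplacian m p + 2 * ∑ i, pderiv i p * pderiv i q := by
  simp only [polyLaplacian_apply, Finset.mul_sum, ← Finset.sum_add_distrib]
  refine Finset.sum_congr rfl fun i _ => ?_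
  simp only [pderiv_mul, map_add]
  ring

theorem pderiv_linForm (w : Amb m) (i : Fin (m + 1)) :
    pderiv i (linForm w) = C ((w i : ℝ) : ℂ) := by
  rw [linForm, map_sum, Finset.sum_eq_single i]
  · simp
  · intro j _ hj
    simp [pderiv_X_of_ne hj]
  · simp

theorem pderiv_sqNorm (i : Fin (m + 1)) : pderiv i (sqNorm m) = 2 * X i := by
  rw [sqNorm, map_sum, Finset.sum_eq_single i]
  · rw [pderiv_mul, pderiv_X_self]; ring
  · intro j _ hj
    simp [pderiv_X_of_ne hj]
  · simp

theorem polyLaplacian_linForm_mul (w : Amb m) (p : Poly m) :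
    polyLaplacian m (linForm w * p) = linForm w * polyLaplacian m p + 2 * dirDeriv w p := by
  have h : polyLaplacian m (linForm w) = 0 := by
    simp [polyLaplacian_apply, pderiv_linForm]
  rw [polyLaplacian_mul, h, dirDeriv_apply]
  simp [pderiv_linForm]

theorem polyLaplacian_X_mul (i : Fin (m + 1)) (p : Poly m) :
    polyLaplacian m (X i * p) = X i * polyLaplacian m p + 2 * pderiv i p := by
  have h : polyLaplacian m (X i) = 0 := by
    rw [polyLaplacian_apply]
    refine Finset.sum_eq_zero fun j _ => ?_
    obtain ⟨c, hc⟩ := pderiv_X_const (m := m) j i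
    rw [hc, pderiv_C]
  rw [polyLaplacian_mul, h, Finset.sum_eq_single i]
  · simp
  · intro j _ hj
    simp [pderiv_X_of_ne hj.symm]
  · simp

theorem polyLaplacian_sqNorm_mul {n : ℕ} {p : Poly m} (hp : p.IsHomogeneous n) :
    polyLaplacian m (sqNorm m * p) =
      sqNorm m * polyLaplacian m p + C ((2 * (m + 1) + 4 * n : ℝ) : ℂ) * p := by
  have h : polyLaplacian m (sqNorm m) = C ((2 * (m + 1) : ℝ) : ℂ) := by
    rw [polyLaplacian_apply]
    have : ∀ i : Fin (m + 1), pderiv i (pderiv i (sqNorm m)) = C 2 := by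
      intro i
      rw [pderiv_sqNorm, show (2 : Poly m) = C 2 from rfl, pderiv_C_mul, pderiv_X_self, mul_one]
    simp only [this, Finset.sum_const, Finset.card_univ, Fintype.card_fin]
    rw [← map_nsmul]
    congr 1
    push_cast
    simp only [nsmul_eq_mul]
    push_cast
    ring
  have h2 : ∑ i, pderiv i (sqNorm m) * pderiv i p = C ((2 * n : ℝ) : ℂ) * p := by
    have := hp.sum_X_mul_pderiv
    simp only [pderiv_sqNorm, mul_assoc, ← Finset.mul_sum, this]
    simp only [Complex.ofReal_mul, Complex.ofReal_natCast, Complex.ofReal_ofNat, map_mul,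
      map_natCast, map_ofNat, nsmul_eq_mul]
    ring
  rw [polyLaplacian_mul, h, h2]
  simp only [Complex.ofReal_mul, Complex.ofReal_add, map_mul, map_add, Complex.ofReal_ofNat,
    map_ofNat]
  ring

theorem dirDeriv_linForm (v w : Amb m) : dirDeriv v (linForm w) = C ((inner ℝ v w : ℝ) : ℂ) := by
  rw [dirDeriv_apply]
  simp only [pderiv_linForm, ← map_mul, ← map_sum]
  congr 1
  rw [PiLp.inner_apply]
  push_cast
  refine Finset.sum_congr rfl fun i _ => ?_
  simp [mul_comm]

theorem dirDeriv_sqNorm (w : Amb m) : dirDeriv w (sqNorm m) = 2 * linForm w := by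
  rw [dirDeriv_apply, linForm, Finset.mul_sum]
  refine Finset.sum_congr rfl fun i _ => ?_
  rw [pderiv_sqNorm]; ring

theorem isHomogeneous_linForm (w : Amb m) : (linForm w).IsHomogeneous 1 := by
  refine IsHomogeneous.sum _ _ _ fun i _ => ?_
  simpa using (isHomogeneous_C (Fin (m + 1)) ((w i : ℝ) : ℂ)).mul (isHomogeneous_X ℂ i)

theorem isHomogeneous_sqNorm : (sqNorm m).IsHomogeneous 2 :=
  IsHomogeneous.sum _ _ _ fun i _ => (isHomogeneous_X ℂ i).mul (isHomogeneous_X ℂ i)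

/-! ### Values of polynomials at real points -/

@[simp] theorem evalAt_C (x : Amb m) (c : ℂ) : evalAt x (C c) = c := by simp [evalAt]

@[simp] theorem evalAt_X (x : Amb m) (i : Fin (m + 1)) : evalAt x (X i) = ((x i : ℝ) : ℂ) := by
  simp [evalAt]

@[simp] theorem evalAt_smul (x : Amb m) (c : ℂ) (p : Poly m) :
    evalAt x (c • p) = c * evalAt x p := by simp [smul_eq_C_mul]

theorem evalAt_linForm (w x : Amb m) : evalAt x (linForm w) = ((inner ℝ w x : ℝ) : ℂ) := by
  simp only [linForm, map_sum, map_mul, evalAt_C, evalAt_X, PiLp.inner_apply]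
  push_cast
  refine Finset.sum_congr rfl fun i _ => ?_
  simp [mul_comm]

theorem evalAt_sqNorm (x : Amb m) : evalAt x (sqNorm m) = ((‖x‖ ^ 2 : ℝ) : ℂ) := by
  simp only [sqNorm, map_sum, map_mul, evalAt_X, EuclideanSpace.real_norm_sq_eq]
  push_cast
  exact Finset.sum_congr rfl fun i _ => by ring

theorem evalAt_smul_point {n : ℕ} {p : Poly m} (hp : p.IsHomogeneous n) (r : ℝ) (x : Amb m) :
    evalAt (r • x) p = (r : ℂ) ^ n * evalAt x p := by
  rw [evalAt, evalAt, eval_eq', eval_eq', Finset.mul_sum]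
  refine Finset.sum_congr rfl fun d hd => ?_
  have hdeg : ∑ i, d i = n := by
    have h1 : d.degree = n := by
      rw [Finsupp.degree_eq_weight_one]; exact hp (mem_support_iff.1 hd)
    rw [← h1, Finsupp.degree_eq_sum]
  simp only [PiLp.smul_apply, smul_eq_mul, Complex.ofReal_mul, mul_pow, Finset.prod_mul_distrib,
    Finset.prod_pow_eq_pow_sum, hdeg]
  ring

theorem evalAt_dirDeriv_self {n : ℕ} {p : Poly m} (hp : p.IsHomogeneous n) (x : Amb m) :
    evalAt x (dirDeriv x p) = n * evalAt x p := by
  have := congrArg (evalAt x) hp.sum_X_mul_pderiv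
  rw [dirDeriv_apply]
  simpa using this

theorem restrictSph_apply (p : Poly m) (x : Sph m) : restrictSph m p x = evalAt (x : Amb m) p := rfl

/-! ### Zonal harmonic polynomials -/

/-- The zonal polynomial `y ↦ |y|ⁿ P_n(w · y / |y|)`, through the homogenised recurrence of the
Legendre polynomials. It is harmonic when `|w| = 1`. -/
noncomputable def zonal (w : Amb m) : ℕ → Poly m
  | 0 => 1
  | 1 => linForm w
  | n + 2 => C (((n + m : ℝ)⁻¹ : ℝ) : ℂ) *
      (C ((2 * n + m + 1 : ℝ) : ℂ) * (linForm w * zonal w (n + 1)) -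
        C ((n + 1 : ℝ) : ℂ) * (sqNorm m * zonal w n))

theorem isHomogeneous_zonal (w : Amb m) : ∀ n, (zonal w n).IsHomogeneous n
  | 0 => isHomogeneous_one _ _
  | 1 => isHomogeneous_linForm w
  | n + 2 => by
    rw [zonal]
    have h1 := (isHomogeneous_linForm w).mul (isHomogeneous_zonal w (n + 1))
    have h2 := (isHomogeneous_sqNorm (m := m)).mul (isHomogeneous_zonal w n)
    rw [show 1 + (n + 1) = n + 2 by ring] at h1
    rw [show 2 + n = n + 2 by ring] at h2
    exact ((h1.C_mul _).sub (h2.C_mul _)).C_mul _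

theorem evalAt_zonal {w y : Amb m} (hy : ‖y‖ = 1) :
    ∀ n, evalAt y (zonal w n) = (legendreP m n (inner ℝ w y) : ℝ)
  | 0 => by simp [zonal, legendreP]
  | 1 => by simp [zonal, legendreP, evalAt_linForm]
  | n + 2 => by
    rw [zonal, legendreP]
    simp only [map_mul, map_sub, evalAt_C, evalAt_linForm, evalAt_sqNorm, hy,
      evalAt_zonal hy n, evalAt_zonal hy (n + 1)]
    push_cast
    ring

theorem zonal_succ_succ (hm : 1 ≤ m) (w : Amb m) (n : ℕ) :
    ((n + m : ℕ) : Poly m) * zonal w (n + 2) =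
      ((2 * n + m + 1 : ℕ) : Poly m) * (linForm w * zonal w (n + 1)) -
        ((n + 1 : ℕ) : Poly m) * (sqNorm m * zonal w n) := by
  have hk : ((n : ℂ) + m) ≠ 0 := by exact_mod_cast (by omega : n + m ≠ 0)
  have h : ((n + m : ℕ) : Poly m) * C (((n + m : ℝ)⁻¹ : ℝ) : ℂ) = 1 := by
    rw [← map_natCast (C : ℂ →+* Poly m), ← map_mul]
    push_cast
    rw [mul_inv_cancel₀ hk, map_one]
  rw [zonal, ← mul_assoc, h, one_mul]
  simp [map_ofNat (C : ℂ →+* Poly m)]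

theorem dirDeriv_mul (w : Amb m) (p q : Poly m) :
    dirDeriv w (p * q) = p * dirDeriv w q + q * dirDeriv w p := by
  simp [Derivation.leibniz]

theorem dirDeriv_natCast_mul (w : Amb m) (k : ℕ) (p : Poly m) :
    dirDeriv w (k * p) = k * dirDeriv w p := by
  simp

/-- The derivative of a zonal polynomial along its axis is a multiple of the previous one. -/
theorem dirDeriv_zonal (hm : 1 ≤ m) {w : Amb m} (hw : ‖w‖ = 1) (n : ℕ) :
    dirDeriv w (zonal w (n + 1)) = ((n + 1 : ℕ) : Poly m) * zonal w n := by
  have hlin : dirDeriv w (linForm w) = 1 := by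
    rw [dirDeriv_linForm, real_inner_self_eq_norm_sq, hw]; simp
  have hne : ∀ k : ℕ, ((k + m : ℕ) : Poly m) ≠ 0 := fun k => by
    exact_mod_cast (by omega : k + m ≠ 0)
  induction n using Nat.twoStepInduction with
  | zero => simp [zonal, hlin]
  | one =>
    refine mul_left_cancel₀ (hne 0) ?_
    rw [← dirDeriv_natCast_mul, zonal_succ_succ hm w 0, map_sub, dirDeriv_natCast_mul,
      dirDeriv_natCast_mul, dirDeriv_mul, dirDeriv_mul, dirDeriv_sqNorm]
    simp only [zonal, Derivation.map_one_eq_zero, hlin]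
    push_cast
    ring
  | more k e0 e1 =>
    refine mul_left_cancel₀ (hne (k + 1)) ?_
    rw [← dirDeriv_natCast_mul, zonal_succ_succ hm w (k + 1), map_sub, dirDeriv_natCast_mul,
      dirDeriv_natCast_mul, dirDeriv_mul, dirDeriv_mul, dirDeriv_sqNorm, e1, e0, hlin]
    have hz := zonal_succ_succ hm w k
    generalize zonal w (k + 2) = z2 at hz ⊢
    generalize zonal w (k + 1) = z1 at hz ⊢
    generalize zonal w k = z0 at hz ⊢
    push_cast at hz ⊢
    linear_combination (-((k : Poly m) + 2)) * hz

theorem zonal_mem_harmPoly (hm : 1 ≤ m) {w : Amb m} (hw : ‖w‖ = 1) (n : ℕ) :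
    zonal w n ∈ harmPoly m n := by
  rw [mem_harmPoly]
  refine ⟨isHomogeneous_zonal w n, ?_⟩
  induction n using Nat.strong_induction_on with
  | _ n ih =>
  match n, ih with
  | 0, _ => simp [zonal, polyLaplacian_apply]
  | 1, _ => simp [zonal, polyLaplacian_apply, pderiv_linForm]
  | n + 2, ih =>
    have hne : ((n + m : ℕ) : Poly m) ≠ 0 := by exact_mod_cast (by omega : n + m ≠ 0)
    refine (mul_eq_zero.1 ?_).resolve_left hne
    have hcast : ∀ (k : ℕ) (p : Poly m), polyLaplacian m (k * p) = k * polyLaplacian m p := by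
      intro k p
      rw [← nsmul_eq_mul, ← nsmul_eq_mul, map_nsmul]
    rw [← hcast, zonal_succ_succ hm, map_sub, hcast, hcast, polyLaplacian_linForm_mul,
      polyLaplacian_sqNorm_mul (isHomogeneous_zonal w n), ih n (by omega), ih (n + 1) (by omega),
      dirDeriv_zonal hm hw]
    push_cast
    simp only [map_add, map_mul, map_natCast, map_one, map_ofNat]
    ring

theorem legendreP_one (hm : 1 ≤ m) : ∀ n, legendreP m n 1 = 1
  | 0 => rfl
  | 1 => rfl
  | n + 2 => by
    have : (n : ℝ) + m ≠ 0 := by positivity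
    rw [legendreP, legendreP_one hm n, legendreP_one hm (n + 1)]
    field_simp
    ring

/-! ### Polynomials on the sphere are sums of spherical harmonics -/

theorem sphericalHarmonics_eq (m n : ℕ) :
    sphericalHarmonics m n = (harmPoly m n).map (restrictSph m) := rfl

theorem evalAt_sqNorm_mul (p : Poly m) (x : Sph m) :
    evalAt (x : Amb m) (sqNorm m * p) = evalAt (x : Amb m) p := by
  rw [map_mul, evalAt_sqNorm, norm_eq_of_mem_sphere]; simp

/-- Multiplication by a coordinate sends spherical harmonics of degree `n` to sums of spherical
harmonics of degrees `n + 1` and `n - 1`: `X i * p = (X i * p - c |x|² ∂ᵢp) + c |x|² ∂ᵢp`, where the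
bracket is harmonic for a suitable `c`. -/
theorem restrictSph_X_mul_mem (hm : 2 ≤ m) {n : ℕ} {p : Poly m} (hp : p ∈ harmPoly m n)
    (i : Fin (m + 1)) :
    restrictSph m (X i * p) ∈ sphericalHarmonics m (n + 1) ⊔ sphericalHarmonics m (n - 1) := by
  have hp' := mem_harmPoly.1 hp
  have hd := pderiv_mem_harmPoly hp i
  have hd' := mem_harmPoly.1 hd
  have hden : (2 * n + m - 1 : ℝ) ≠ 0 := by
    have : (2 : ℝ) ≤ m := by exact_mod_cast hm
    have : (0 : ℝ) ≤ n := by positivity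
    linarith
  rcases Nat.eq_zero_or_pos n with rfl | hn
  · have h0 : pderiv i p = 0 := by
      obtain ⟨c, rfl⟩ : ∃ c, p = C c := ⟨_, totalDegree_eq_zero_iff_eq_C.1 (Nat.le_zero.1 hp'.1.totalDegree_le)⟩
      simp
    refine Submodule.mem_sup_left ⟨X i * p, ?_, rfl⟩
    refine mem_harmPoly.2 ⟨by simpa [add_comm] using (isHomogeneous_X ℂ i).mul hp'.1, ?_⟩
    rw [polyLaplacian_X_mul, hp'.2, h0]; simp
  set c : ℂ := (((2 * n + m - 1 : ℝ)⁻¹ : ℝ) : ℂ) with hc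
  have hdeg : (sqNorm m * pderiv i p).IsHomogeneous (n + 1) := by
    have := (isHomogeneous_sqNorm (m := m)).mul hd'.1
    rwa [show 2 + (n - 1) = n + 1 by omega] at this
  have hsub : X i * p - C c * (sqNorm m * pderiv i p) ∈ harmPoly m (n + 1) := by
    refine mem_harmPoly.2 ⟨?_, ?_⟩
    · refine IsHomogeneous.sub ?_ (hdeg.C_mul c)
      simpa [add_comm] using (isHomogeneous_X ℂ i).mul hp'.1
    · rw [map_sub, polyLaplacian_X_mul, hp'.2, ← smul_eq_C_mul, map_smul,
        polyLaplacian_sqNorm_mul hd'.1, hd'.2, smul_eq_C_mul]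
      have : C c * C ((2 * (m + 1) + 4 * ((n - 1 : ℕ) : ℝ) : ℝ) : ℂ) = (C 2 : Poly m) := by
        rw [← map_mul, hc, ← Complex.ofReal_mul]
        congr 1
        rw [Nat.cast_sub hn, show (2 * (m + 1) + 4 * ((n : ℝ) - (1 : ℕ)) : ℝ) =
          2 * (2 * n + m - 1) by push_cast; ring]
        rw [mul_comm, mul_assoc, mul_inv_cancel₀ hden]; simp
      rw [mul_zero, zero_add, mul_zero, zero_add, ← mul_assoc, this,
        show (C 2 : Poly m) = 2 from rfl, sub_self]
  have hsum : restrictSph m (X i * p) =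
      restrictSph m (X i * p - C c * (sqNorm m * pderiv i p)) +
        restrictSph m (C c * pderiv i p) := by
    ext x
    rw [Pi.add_apply, restrictSph_apply, restrictSph_apply, restrictSph_apply,
      map_sub (evalAt _), map_mul (evalAt _) (C c), map_mul (evalAt _) (C c), evalAt_sqNorm_mul]
    ring
  rw [hsum]
  refine Submodule.add_mem_sup ⟨_, hsub, rfl⟩ ⟨_, ?_, rfl⟩
  rw [← smul_eq_C_mul]
  exact Submodule.smul_mem _ c hd

/-- The functions on the sphere that are sums of spherical harmonics of degree less than `n`. -/
noncomputable def harmonicsBelow (m n : ℕ) : Submodule ℂ (Sph m → ℂ) :=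
  ⨆ j : Fin n, sphericalHarmonics m j

theorem harmonicsBelow_mono : Monotone (harmonicsBelow m) := by
  intro a b hab
  refine iSup_le fun j => ?_
  exact le_iSup (fun j : Fin b => sphericalHarmonics m j) ⟨j, j.2.trans_le hab⟩

theorem restrictSph_monomial_mem (hm : 2 ≤ m) (d : Fin (m + 1) →₀ ℕ) (c : ℂ) :
    restrictSph m (monomial d c) ∈ harmonicsBelow m (d.degree + 1) := by
  have key : ∀ (i : Fin (m + 1)) (n : ℕ) (p : Poly m),
      restrictSph m p ∈ harmonicsBelow m n →
        restrictSph m (X i * p) ∈ harmonicsBelow m (n + 1) := by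
    intro i n p hp
    obtain ⟨L, hL⟩ : ∃ L : (Sph m → ℂ) →ₗ[ℂ] (Sph m → ℂ), ∀ f x,
        L f x = evalAt (x : Amb m) (X i) * f x :=
      ⟨LinearMap.mulLeft ℂ (fun x : Sph m => evalAt (x : Amb m) (X i)), fun f x => rfl⟩
    have hLp : ∀ q : Poly m, restrictSph m (X i * q) = L (restrictSph m q) := by
      intro q; ext x; rw [hL, restrictSph_apply, restrictSph_apply, map_mul]
    have hle : harmonicsBelow m n ≤ (harmonicsBelow m (n + 1)).comap L := by
      refine iSup_le fun j => ?_
      rintro _ ⟨q, hq, rfl⟩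
      rw [Submodule.mem_comap, ← hLp]
      refine (sup_le ?_ ?_ : sphericalHarmonics m (j + 1) ⊔ sphericalHarmonics m (j - 1) ≤
        harmonicsBelow m (n + 1)) (restrictSph_X_mul_mem hm hq i)
      · exact le_iSup (fun j : Fin (n + 1) => sphericalHarmonics m j) ⟨j + 1, by omega⟩
      · exact le_iSup (fun j : Fin (n + 1) => sphericalHarmonics m j) ⟨j - 1, by omega⟩
    rw [hLp]
    exact hle hp
  induction hk : d.degree generalizing d with
  | zero =>
    obtain rfl : d = 0 := (Finsupp.degree_eq_zero_iff d).1 hk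
    refine Submodule.mem_iSup_of_mem (0 : Fin (0 + 1)) ⟨C c, ?_, rfl⟩
    exact mem_harmPoly.2 ⟨isHomogeneous_C _ _, by simp [polyLaplacian_apply]⟩
  | succ k ih =>
    have hd : d ≠ 0 := by rintro rfl; simp at hk
    obtain ⟨i, hi⟩ := Finsupp.support_nonempty_iff.2 hd
    have hle : Finsupp.single i 1 ≤ d :=
      Finsupp.single_le_iff.2 (Nat.one_le_iff_ne_zero.2 (Finsupp.mem_support_iff.1 hi))
    have hdd : Finsupp.single i 1 + (d - Finsupp.single i 1) = d := add_tsub_cancel_of_le hle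
    have hdeg : (d - Finsupp.single i 1).degree = k := by
      have := congrArg Finsupp.degree hdd
      rw [map_add, Finsupp.degree_single, hk] at this
      omega
    have := key i _ _ (ih _ hdeg)
    rwa [X, monomial_mul, one_mul, hdd] at this

/-- The restriction of a polynomial to the sphere is a sum of spherical harmonics of degrees at
most its total degree. -/
theorem restrictSph_mem_harmonicsBelow (hm : 2 ≤ m) {n : ℕ} {p : Poly m}
    (hp : p.totalDegree < n) : restrictSph m p ∈ harmonicsBelow m n := by
  rw [p.as_sum, map_sum]
  refine Submodule.sum_mem _ fun d hd => ?_
  refine harmonicsBelow_mono ?_ (restrictSph_monomial_mem hm d _)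
  have := le_totalDegree hd
  rw [Finsupp.sum_fintype _ _ (fun _ => rfl)] at this
  rw [Finsupp.degree_eq_sum]
  omega

/-! ### Gaussian integrals of polynomials -/

section Gaussian

variable {V : Type*} [NormedAddCommGroup V] [InnerProductSpace ℝ V]

/-- Polynomials grow at most exponentially. This class of bounds is visibly closed under sums and
products, and the Gaussian weight absorbs it. -/
theorem exists_norm_evalAt_le_exp (p : Poly m) :
    ∃ c a : ℝ, ∀ x : Amb m, ‖evalAt x p‖ ≤ c * Real.exp (a * ‖x‖) := by
  induction p using MvPolynomial.induction_on with
  | C z => exact ⟨‖z‖, 0, fun x => by simp⟩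
  | add p q hp hq =>
    obtain ⟨c, a, h⟩ := hp
    obtain ⟨c', a', h'⟩ := hq
    have hc : 0 ≤ c := by simpa using (norm_nonneg _).trans (h 0)
    have hc' : 0 ≤ c' := by simpa using (norm_nonneg _).trans (h' 0)
    refine ⟨c + c', max a a', fun x => ?_⟩
    rw [map_add, add_mul]
    refine (norm_add_le _ _).trans (add_le_add ((h x).trans ?_) ((h' x).trans ?_))
    · gcongr; exact le_max_left _ _
    · gcongr; exact le_max_right _ _
  | mul_X p i hp =>
    obtain ⟨c, a, h⟩ := hp
    have hc : 0 ≤ c := by simpa using (norm_nonneg _).trans (h 0)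
    refine ⟨c, a + 1, fun x => ?_⟩
    rw [map_mul, norm_mul, evalAt_X, add_mul, one_mul, Real.exp_add, ← mul_assoc]
    have h1 : ‖((x i : ℝ) : ℂ)‖ ≤ Real.exp ‖x‖ := by
      rw [Complex.norm_real]
      have := PiLp.norm_apply_le x i
      linarith [Real.add_one_le_exp ‖x‖]
    gcongr
    exact h x

theorem continuous_evalAt (p : Poly m) : Continuous fun x : Amb m => evalAt x p := by
  unfold evalAt
  refine (MvPolynomial.continuous_eval p).comp ?_
  fun_prop

theorem hasLineDerivAt_evalAt (ι : V →ₗᵢ[ℝ] Amb m) (p : Poly m) (v w : V) :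
    HasLineDerivAt ℝ (fun v => evalAt (ι v) p) (evalAt (ι v) (dirDeriv (ι w) p)) v w := by
  unfold HasLineDerivAt
  induction p using MvPolynomial.induction_on with
  | C z => simpa [dirDeriv] using hasDerivAt_const (0 : ℝ) z
  | add p q hp hq =>
    simp only [map_add (evalAt _), map_add (dirDeriv _)]
    exact hp.add hq
  | mul_X p i hp =>
    have hX : HasDerivAt (fun t : ℝ => evalAt (ι (v + t • w)) (X i : Poly m))
        (((ι w) i : ℝ) : ℂ) 0 := by
      simp only [evalAt_X]
      have h0 : HasDerivAt (fun t : ℝ => (ι (v + t • w)) i) ((ι w) i) 0 := by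
        have := ((hasDerivAt_id (0 : ℝ)).mul_const ((ι w) i)).const_add ((ι v) i)
        simpa using this
      exact h0.ofReal_comp
    have := hp.mul hX
    simp only [map_mul (evalAt _), dirDeriv_mul, map_add (evalAt _), dirDeriv_X, evalAt_C]
    simp only [zero_smul, add_zero] at this
    refine this.congr_deriv ?_
    simp only [evalAt_X]
    ring

theorem hasLineDerivAt_gauss (v w : V) :
    HasLineDerivAt ℝ (fun v : V => (Real.exp (-‖v‖ ^ 2 / 2) : ℂ))
      (-(inner ℝ v w : ℝ) * (Real.exp (-‖v‖ ^ 2 / 2) : ℂ)) v w := by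
  unfold HasLineDerivAt
  have h1 : HasDerivAt (fun t : ℝ => v + t • w) w 0 := by
    simpa using ((hasDerivAt_id (0 : ℝ)).smul_const w).const_add v
  have h2 := ((h1.norm_sq.fun_neg.div_const 2).exp).ofReal_comp
  simp only [zero_smul, add_zero] at h2
  refine h2.congr_deriv ?_
  push_cast
  ring

variable [FiniteDimensional ℝ V] [MeasurableSpace V] [BorelSpace V]

/-- The integral of a polynomial against `exp (-|v|² / 2)` over an isometrically embedded subspace. -/
noncomputable def gaussInt (ι : V →ₗᵢ[ℝ] Amb m) (p : Poly m) : ℂ :=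
  ∫ v, evalAt (ι v) p * (Real.exp (-‖v‖ ^ 2 / 2) : ℂ)

/-- The integral of a polynomial over the unit sphere of an isometrically embedded subspace. -/
noncomputable def sphereInt (ι : V →ₗᵢ[ℝ] Amb m) (p : Poly m) : ℂ :=
  ∫ u : Metric.sphere (0 : V) 1, evalAt (ι u) p ∂(volume : Measure V).toSphere

theorem integrable_gauss (ι : V →ₗᵢ[ℝ] Amb m) (p : Poly m) :
    Integrable fun v : V => evalAt (ι v) p * (Real.exp (-‖v‖ ^ 2 / 2) : ℂ) := by
  obtain ⟨c, a, h⟩ := exists_norm_evalAt_le_exp p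
  have hc : 0 ≤ c := by simpa using (norm_nonneg _).trans (h 0)
  have hint : Integrable fun v : V => Real.exp (-(1 / 4) * ‖v‖ ^ 2) := by
    have := (GaussianFourier.integrable_cexp_neg_mul_sq_norm_add (V := V)
      (b := (1 / 4 : ℝ)) (by simp) 0 0).re
    refine this.congr (Eventually.of_forall fun v => ?_)
    simp only [inner_zero_left, Complex.ofReal_zero, mul_zero, add_zero]
    rw [← Complex.ofReal_pow, ← Complex.ofReal_neg, ← Complex.ofReal_mul, ← Complex.ofReal_exp]
    rfl
  refine (hint.const_mul (c * Real.exp (a ^ 2))).mono' ?_ (Eventually.of_forall fun v => ?_)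
  · refine Continuous.aestronglyMeasurable ?_
    exact ((continuous_evalAt p).comp ι.continuous).mul (by fun_prop)
  · rw [norm_mul, Complex.norm_real, Real.norm_of_nonneg (Real.exp_pos _).le, mul_assoc,
      ← Real.exp_add]
    refine (mul_le_mul_of_nonneg_right (h _) (Real.exp_pos _).le).trans ?_
    rw [mul_assoc, ← Real.exp_add, ι.norm_map]
    refine mul_le_mul_of_nonneg_left (Real.exp_le_exp.2 ?_) hc
    nlinarith [sq_nonneg (a - ‖v‖ / 2)]

/-- Gaussian integration by parts. -/
theorem gaussInt_dirDeriv (ι : V →ₗᵢ[ℝ] Amb m) (p : Poly m) (w : V) :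
    gaussInt ι (dirDeriv (ι w) p) = gaussInt ι (linForm (ι w) * p) := by
  have key := integral_bilinear_hasLineDerivAt_right_eq_neg_left_of_integrable
    (μ := (volume : Measure V)) (B := ContinuousLinearMap.mul ℝ ℂ) (v := w)
    (f := fun v : V => evalAt (ι v) p) (f' := fun v => evalAt (ι v) (dirDeriv (ι w) p))
    (g := fun v : V => (Real.exp (-‖v‖ ^ 2 / 2) : ℂ))
    (g' := fun v => -(inner ℝ v w : ℝ) * (Real.exp (-‖v‖ ^ 2 / 2) : ℂ))
  have e : ∀ v : V, evalAt (ι v) (linForm (ι w) * p) * (Real.exp (-‖v‖ ^ 2 / 2) : ℂ) =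
      - (evalAt (ι v) p * (-(inner ℝ v w : ℝ) * (Real.exp (-‖v‖ ^ 2 / 2) : ℂ))) := by
    intro v
    rw [map_mul, evalAt_linForm, ι.inner_map_map, real_inner_comm]
    ring
  have hint := integrable_gauss ι (linForm (ι w) * p)
  simp only [e] at hint
  have := key (by simpa using integrable_gauss ι (dirDeriv (ι w) p)) (by simpa using hint.neg)
    (by simpa using integrable_gauss ι p) (fun v _ => hasLineDerivAt_evalAt ι p v w)
    (fun v _ => hasLineDerivAt_gauss v w)
  simp only [ContinuousLinearMap.mul_apply'] at this
  unfold gaussInt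
  simp only [e]
  rw [integral_neg, this, neg_neg]

theorem gaussInt_add (ι : V →ₗᵢ[ℝ] Amb m) (p q : Poly m) :
    gaussInt ι (p + q) = gaussInt ι p + gaussInt ι q := by
  unfold gaussInt
  simp only [map_add, add_mul]
  exact integral_add (integrable_gauss ι p) (integrable_gauss ι q)

theorem gaussInt_smul (ι : V →ₗᵢ[ℝ] Amb m) (c : ℂ) (p : Poly m) :
    gaussInt ι (c • p) = c * gaussInt ι p := by
  unfold gaussInt
  simp only [evalAt_smul, mul_assoc]
  exact integral_const_mul _ _

/-- `gaussInt` as a linear functional. -/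
noncomputable def gaussIntₗ (ι : V →ₗᵢ[ℝ] Amb m) : Poly m →ₗ[ℂ] ℂ where
  toFun := gaussInt ι
  map_add' := gaussInt_add ι
  map_smul' := gaussInt_smul ι

/-- The radial factor of the Gaussian integral of a homogeneous polynomial of degree `k` over a
space of dimension `d`. -/
noncomputable def radialFactor (d k : ℕ) : ℝ :=
  ∫ r : Set.Ioi (0 : ℝ), (r : ℝ) ^ k * Real.exp (-(r : ℝ) ^ 2 / 2) ∂Measure.volumeIoiPow (d - 1)

theorem gaussInt_eq_radialFactor_mul [Nontrivial V] (ι : V →ₗᵢ[ℝ] Amb m) {k : ℕ} {p : Poly m}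
    (hp : p.IsHomogeneous k) :
    gaussInt ι p = radialFactor (Module.finrank ℝ V) k * sphereInt ι p := by
  have hpt : ∀ x : ({0}ᶜ : Set V), evalAt (ι x) p * (Real.exp (-‖(x : V)‖ ^ 2 / 2) : ℂ) =
      (fun y : Metric.sphere (0 : V) 1 × Set.Ioi (0 : ℝ) => evalAt (ι (y.1 : V)) p *
        (((y.2 : ℝ) ^ k * Real.exp (-(y.2 : ℝ) ^ 2 / 2) : ℝ) : ℂ))
        (homeomorphUnitSphereProd V x) := by
    intro x
    have hx : ‖(x : V)‖ ≠ 0 := norm_ne_zero_iff.2 x.2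
    have : ι (x : V) = ‖(x : V)‖ • ι ((homeomorphUnitSphereProd V x).1 : V) := by
      rw [← map_smul]
      congr 1
      simp [smul_smul, hx]
    dsimp only
    rw [this, evalAt_smul_point hp, homeomorphUnitSphereProd_apply_snd_coe]
    push_cast
    ring
  calc gaussInt ι p = ∫ x : ({0}ᶜ : Set V), evalAt (ι x) p *
        (Real.exp (-‖(x : V)‖ ^ 2 / 2) : ℂ) ∂(volume.comap Subtype.val) := by
        rw [integral_subtype_comap (measurableSet_singleton _).compl
          fun x : V ↦ evalAt (ι x) p * (Real.exp (-‖x‖ ^ 2 / 2) : ℂ)]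
        unfold gaussInt
        rw [restrict_compl_singleton]
    _ = ∫ y : Metric.sphere (0 : V) 1 × Set.Ioi (0 : ℝ), evalAt (ι (y.1 : V)) p *
        (((y.2 : ℝ) ^ k * Real.exp (-(y.2 : ℝ) ^ 2 / 2) : ℝ) : ℂ)
          ∂((volume : Measure V).toSphere.prod (.volumeIoiPow (Module.finrank ℝ V - 1))) := by
        simp only [hpt]
        exact (volume : Measure V).measurePreserving_homeomorphUnitSphereProd.integral_comp
          (homeomorphUnitSphereProd V).measurableEmbedding
          (fun y : Metric.sphere (0 : V) 1 × Set.Ioi (0 : ℝ) => evalAt (ι (y.1 : V)) p *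
            (((y.2 : ℝ) ^ k * Real.exp (-(y.2 : ℝ) ^ 2 / 2) : ℝ) : ℂ))
    _ = _ := by
        rw [integral_prod_mul (fun u : Metric.sphere (0 : V) 1 => evalAt (ι u) p)
          (fun r : Set.Ioi (0 : ℝ) => (((r : ℝ) ^ k * Real.exp (-(r : ℝ) ^ 2 / 2) : ℝ) : ℂ)),
          integral_complex_ofReal, mul_comm]
        rfl

theorem radialFactor_pos (d k : ℕ) : 0 < radialFactor d k := by
  unfold radialFactor Measure.volumeIoiPow
  simp only [ENNReal.ofReal]
  rw [integral_withDensity_eq_integral_smul (measurable_subtype_coe.pow_const _).real_toNNReal,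
    integral_subtype_comap measurableSet_Ioi fun a : ℝ ↦ Real.toNNReal (a ^ (d - 1)) •
      (a ^ k * Real.exp (-a ^ 2 / 2)),
    setIntegral_congr_fun (g := fun x : ℝ => x ^ ((d - 1 + k : ℕ) : ℝ) *
      Real.exp (-(1 / 2) * x ^ (2 : ℝ))) measurableSet_Ioi fun x hx ↦ ?_]
  · rw [integral_rpow_mul_exp_neg_mul_rpow (by norm_num)
      (by have : (0 : ℝ) ≤ ((d - 1 + k : ℕ) : ℝ) := by positivity
          linarith) (by norm_num)]
    have : 0 < Real.Gamma ((((d - 1 + k : ℕ) : ℝ) + 1) / 2) := Real.Gamma_pos_of_pos (by positivity)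
    positivity
  · dsimp only
    rw [NNReal.smul_def, Real.coe_toNNReal _ (pow_nonneg hx.out.le _), smul_eq_mul,
      Real.rpow_natCast, pow_add, show (2 : ℝ) = ((2 : ℕ) : ℝ) by norm_num, Real.rpow_natCast]
    rw [mul_assoc]
    congr 3
    push_cast
    ring

end Gaussian

/-! ### Integrals of harmonic polynomials over spheres -/

section Subspace

/-- The Laplacian is the sum of the second derivatives along any finite family that satisfies
Parseval's identity, in particular along any orthonormal basis. -/
theorem polyLaplacian_eq_sum_dirDeriv {κ : Type*} [Fintype κ] (f : κ → Amb m)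
    (hf : ∀ x z : Amb m, ∑ k, inner ℝ x (f k) * inner ℝ (f k) z = inner ℝ x z) (p : Poly m) :
    ∑ k, dirDeriv (f k) (dirDeriv (f k) p) = polyLaplacian m p := by
  have h : ∀ k, dirDeriv (f k) (dirDeriv (f k) p) =
      ∑ i, ∑ j, C (((f k i * f k j : ℝ)) : ℂ) * pderiv i (pderiv j p) := by
    intro k
    rw [dirDeriv_apply]
    refine Finset.sum_congr rfl fun i _ => ?_
    rw [dirDeriv_apply, map_sum, Finset.mul_sum]
    refine Finset.sum_congr rfl fun j _ => ?_
    rw [pderiv_C_mul, ← mul_assoc, ← map_mul, ← Complex.ofReal_mul]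
  simp only [h]
  rw [Finset.sum_comm, polyLaplacian_apply]
  refine Finset.sum_congr rfl fun i _ => ?_
  rw [Finset.sum_comm, Finset.sum_eq_single i]
  · rw [← Finset.sum_mul, ← map_sum, ← Complex.ofReal_sum]
    have := hf (EuclideanSpace.single i 1) (EuclideanSpace.single i 1)
    simp only [EuclideanSpace.inner_single_left, EuclideanSpace.inner_single_right] at this
    simp at this
    rw [this]; simp
  · intro j _ hj
    rw [← Finset.sum_mul, ← map_sum, ← Complex.ofReal_sum]
    have := hf (EuclideanSpace.single i 1) (EuclideanSpace.single j 1)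
    simp only [EuclideanSpace.inner_single_left, EuclideanSpace.inner_single_right] at this
    simp [hj] at this
    rw [this]; simp
  · simp

/-- The derivative of a polynomial at a point, as a linear map in the direction. -/
noncomputable def evalDirDeriv (x : Amb m) (p : Poly m) : Amb m →ₗ[ℝ] ℂ where
  toFun w := evalAt x (dirDeriv w p)
  map_add' v w := by
    simp only [dirDeriv_apply, map_sum, map_mul, evalAt_C, ← Finset.sum_add_distrib]
    refine Finset.sum_congr rfl fun i _ => ?_
    simp [add_mul]
  map_smul' c w := by
    simp only [dirDeriv_apply, map_sum, map_mul, evalAt_C, Finset.smul_sum]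
    refine Finset.sum_congr rfl fun i _ => ?_
    simp [mul_assoc]

variable {V : Type*} [NormedAddCommGroup V] [InnerProductSpace ℝ V] [FiniteDimensional ℝ V]
  [MeasurableSpace V] [BorelSpace V]

/-- Green's formula for the Gaussian weight: the Dirichlet form applied to a homogeneous
polynomial counts its degree. -/
theorem sum_gaussInt_dirDeriv_mul (ι : V →ₗᵢ[ℝ] Amb m) {κ : Type*} [Fintype κ]
    (b : OrthonormalBasis κ ℝ V) (p : Poly m) {n : ℕ} {q : Poly m} (hq : q.IsHomogeneous n) :
    ∑ j, gaussInt ι (dirDeriv (ι (b j)) (p * dirDeriv (ι (b j)) q)) = n * gaussInt ι (p * q) := by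
  simp only [gaussInt_dirDeriv]
  unfold gaussInt
  rw [← integral_finsetSum _ fun j _ => integrable_gauss ι _, ← integral_const_mul]
  congr 1
  ext v
  rw [← Finset.sum_mul, ← mul_assoc]
  congr 1
  have h1 : ∑ j, (inner ℝ (b j) v) • ι (b j) = ι v := by
    simp only [← map_smul, ← map_sum, b.sum_repr' v]
  have h2 := evalAt_dirDeriv_self hq (ι v)
  change evalDirDeriv (ι v) q (ι v) = _ at h2
  nth_rw 2 [← h1] at h2
  rw [map_sum] at h2
  rw [map_mul, mul_left_comm, ← h2, Finset.mul_sum]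
  refine Finset.sum_congr rfl fun j _ => ?_
  rw [map_mul, map_mul, evalAt_linForm, ι.inner_map_map, map_smul, Complex.real_smul]
  change _ = _ * (_ * evalAt (ι v) (dirDeriv (ι (b j)) q))
  ring

end Subspace

instance : IsFiniteMeasure (surf m) := by unfold surf; infer_instance

instance (y : Sph m) : IsFiniteMeasure (equatorMeasure y) := by
  unfold equatorMeasure; infer_instance

theorem integrable_of_continuous_of_compactSpace {X : Type*} [TopologicalSpace X] [CompactSpace X]
    [MeasurableSpace X] [OpensMeasurableSpace X] {μ : Measure X} [IsFiniteMeasure μ]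
    {f : X → ℂ} (hf : Continuous f) : Integrable f μ :=
  (BoundedContinuousFunction.mkOfCompact ⟨f, hf⟩).integrable μ

theorem integrable_evalAt (p : Poly m) :
    Integrable (fun x : Sph m => evalAt (x : Amb m) p) (surf m) := by
  have hc : Continuous fun x : Sph m => evalAt (x : Amb m) p :=
    (continuous_evalAt p).comp continuous_subtype_val
  exact integrable_of_continuous_of_compactSpace hc

/-- The integral of a polynomial over the sphere. -/
noncomputable def sphInt (p : Poly m) : ℂ := ∫ x : Sph m, evalAt (x : Amb m) p ∂(surf m)

theorem gaussInt_id {k : ℕ} {p : Poly m} (hp : p.IsHomogeneous k) :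
    gaussInt LinearIsometry.id p = radialFactor (m + 1) k * sphInt p := by
  rw [gaussInt_eq_radialFactor_mul _ hp, finrank_euclideanSpace_fin]
  rfl

theorem gaussInt_id_eq_zero_iff {k : ℕ} {p : Poly m} (hp : p.IsHomogeneous k) :
    gaussInt LinearIsometry.id p = 0 ↔ sphInt p = 0 := by
  rw [gaussInt_id hp]
  simp [(radialFactor_pos (m + 1) k).ne']

/-- For harmonic `q` of degree `n`, the Dirichlet form of `p` and `q` is `n` times their Gaussian
pairing. Its symmetry in `p` and `q` gives orthogonality of different degrees. -/
theorem natCast_mul_gaussInt_eq (p : Poly m) {n : ℕ} {q : Poly m} (hq : q ∈ harmPoly m n) :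
    (n : ℂ) * gaussInt LinearIsometry.id (p * q) =
      gaussInt LinearIsometry.id (∑ i : Fin (m + 1),
        dirDeriv (EuclideanSpace.basisFun (Fin (m + 1)) ℝ i) p *
        dirDeriv (EuclideanSpace.basisFun (Fin (m + 1)) ℝ i) q) := by
  rw [mem_harmPoly] at hq
  set b := EuclideanSpace.basisFun (Fin (m + 1)) ℝ with hb
  rw [← sum_gaussInt_dirDeriv_mul LinearIsometry.id b p hq.1]
  change ∑ j, gaussIntₗ LinearIsometry.id (dirDeriv (b j) (p * dirDeriv (b j) q)) =
    gaussIntₗ LinearIsometry.id _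
  rw [← map_sum]
  simp only [dirDeriv_mul]
  rw [Finset.sum_add_distrib, ← Finset.mul_sum, polyLaplacian_eq_sum_dirDeriv, hq.2]
  · simp [mul_comm]
  · intro x z
    exact b.sum_inner_mul_inner x z

/-- Harmonic homogeneous polynomials of different degrees are orthogonal on the sphere. -/
theorem sphInt_mul_eq_zero {a b : ℕ} (hab : a ≠ b) {p q : Poly m} (hp : p ∈ harmPoly m a)
    (hq : q ∈ harmPoly m b) : sphInt (p * q) = 0 := by
  have h1 := natCast_mul_gaussInt_eq p hq
  have h2 := natCast_mul_gaussInt_eq q hp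
  have h3 : (b : ℂ) * gaussInt LinearIsometry.id (p * q) =
      a * gaussInt LinearIsometry.id (p * q) := by
    rw [h1, mul_comm p q, h2]
    simp only [mul_comm]
  rw [← gaussInt_id_eq_zero_iff ((mem_harmPoly.1 hp).1.mul (mem_harmPoly.1 hq).1)]
  by_contra h
  exact hab (by exact_mod_cast (mul_right_cancel₀ h h3).symm)

theorem eq_C_of_mem_harmPoly_zero {p : Poly m} (hp : p ∈ harmPoly m 0) : ∃ c, p = C c :=
  ⟨_, totalDegree_eq_zero_iff_eq_C.1 (Nat.le_zero.1 (mem_harmPoly.1 hp).1.totalDegree_le)⟩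

/-- The Gaussian form of the reproducing property. The constant depends on the degree only: each
step replaces `Y` by `∂_w Y`, whose value at `w` is a multiple of that of `Y`. -/
theorem exists_gaussInt_zonal_mul (hm : 1 ≤ m) (n : ℕ) : ∃ k : ℂ, ∀ w : Amb m, ‖w‖ = 1 →
    ∀ Y ∈ harmPoly m n, gaussInt LinearIsometry.id (zonal w n * Y) = k * evalAt w Y := by
  have h0 : ∀ w : Amb m, ‖w‖ = 1 → ∀ Y ∈ harmPoly m 0,
      gaussInt LinearIsometry.id Y = gaussInt LinearIsometry.id (1 : Poly m) * evalAt w Y := by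
    intro w _ Y hY
    obtain ⟨c, rfl⟩ := eq_C_of_mem_harmPoly_zero hY
    rw [evalAt_C, mul_comm, ← gaussInt_smul, smul_eq_C_mul, mul_one]
  induction n using Nat.twoStepInduction with
  | zero => exact ⟨_, by simpa [zonal] using h0⟩
  | one =>
    refine ⟨gaussInt LinearIsometry.id (1 : Poly m), fun w hw Y hY => ?_⟩
    have := gaussInt_dirDeriv LinearIsometry.id Y w
    rw [LinearIsometry.id_apply] at this
    rw [zonal, ← this, h0 w hw _ (dirDeriv_mem_harmPoly hY w),
      evalAt_dirDeriv_self (mem_harmPoly.1 hY).1]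
    simp
  | more n _ ih =>
    obtain ⟨k, hk⟩ := ih
    refine ⟨(2 * n + m + 1) / (n + m) * (k * (n + 2)), fun w hw Y hY => ?_⟩
    have hz := zonal_mem_harmPoly hm hw
    have hY' := mem_harmPoly.1 hY
    have hne : ((n : ℂ) + m) ≠ 0 := by exact_mod_cast (by omega : n + m ≠ 0)
    -- the term with `|y|²` integrates to zero by orthogonality of degrees `n` and `n + 2`
    have e1 : gaussInt LinearIsometry.id (zonal w n * Y) = 0 :=
      (gaussInt_id_eq_zero_iff ((isHomogeneous_zonal w n).mul hY'.1)).2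
        (sphInt_mul_eq_zero (by omega) (hz n) hY)
    have e2 : gaussInt LinearIsometry.id (sqNorm m * (zonal w n * Y)) = 0 := by
      refine (gaussInt_id_eq_zero_iff
        (isHomogeneous_sqNorm.mul ((isHomogeneous_zonal w n).mul hY'.1))).2 ?_
      rw [← sphInt_mul_eq_zero (by omega) (hz n) hY]
      unfold sphInt
      simp only [evalAt_sqNorm_mul]
    have e3 : gaussInt LinearIsometry.id (linForm w * (zonal w (n + 1) * Y)) =
        k * (n + 2) * evalAt w Y := by
      have h := gaussInt_dirDeriv LinearIsometry.id (zonal w (n + 1) * Y) w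
      rw [LinearIsometry.id_apply] at h
      rw [← h, dirDeriv_mul, dirDeriv_zonal hm hw, gaussInt_add, hk w hw _ (dirDeriv_mem_harmPoly hY w),
        evalAt_dirDeriv_self hY'.1, show Y * (((n + 1 : ℕ) : Poly m) * zonal w n) =
          ((n + 1 : ℕ) : ℂ) • (zonal w n * Y) by
            rw [smul_eq_C_mul, map_natCast]; ring, gaussInt_smul, e1]
      push_cast
      ring
    have hrec : ((n + m : ℕ) : ℂ) • (zonal w (n + 2) * Y) =
        ((2 * n + m + 1 : ℕ) : ℂ) • (linForm w * (zonal w (n + 1) * Y)) +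
          (-((n + 1 : ℕ) : ℂ)) • (sqNorm m * (zonal w n * Y)) := by
      simp only [smul_eq_C_mul, map_neg, map_natCast]
      linear_combination Y * zonal_succ_succ hm w n
    have := congrArg (gaussInt LinearIsometry.id) hrec
    rw [gaussInt_add, gaussInt_smul, gaussInt_smul, gaussInt_smul, e2, e3] at this
    push_cast at this
    field_simp
    linear_combination this

/-- The zonal polynomials reproduce the harmonic polynomials of their degree, up to a constant. -/
theorem exists_sphInt_zonal_mul (hm : 1 ≤ m) (n : ℕ) : ∃ k : ℂ, ∀ w : Amb m, ‖w‖ = 1 →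
    ∀ Y ∈ harmPoly m n, sphInt (zonal w n * Y) = k * evalAt w Y := by
  obtain ⟨k, hk⟩ := exists_gaussInt_zonal_mul hm n
  refine ⟨k / radialFactor (m + 1) (n + n), fun w hw Y hY => ?_⟩
  have h := hk w hw Y hY
  rw [gaussInt_id ((isHomogeneous_zonal w n).mul (mem_harmPoly.1 hY).1)] at h
  have : ((radialFactor (m + 1) (n + n) : ℝ) : ℂ) ≠ 0 := by
    exact_mod_cast (radialFactor_pos _ _).ne'
  field_simp
  linear_combination h

/-! ### Spherical means of spherical harmonics -/

/-- The inclusion of the hyperplane orthogonal to `y`. -/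
noncomputable abbrev hyperplaneIncl (y : Sph m) :
    ((ℝ ∙ (y : Amb m))ᗮ : Submodule ℝ (Amb m)) →ₗᵢ[ℝ] Amb m :=
  ((ℝ ∙ (y : Amb m))ᗮ).subtypeₗᵢ

theorem sph_ne_zero (y : Sph m) : (y : Amb m) ≠ 0 := ne_zero_of_mem_unit_sphere y

theorem finrank_hyperplane (y : Sph m) : Module.finrank ℝ ((ℝ ∙ (y : Amb m))ᗮ : Submodule ℝ (Amb m)) = m := by
  have : Fact (Module.finrank ℝ (Amb m) = m + 1) := ⟨finrank_euclideanSpace_fin⟩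
  exact Submodule.finrank_orthogonal_span_singleton (sph_ne_zero y)

theorem nontrivial_hyperplane (hm : 1 ≤ m) (y : Sph m) :
    Nontrivial ((ℝ ∙ (y : Amb m))ᗮ : Submodule ℝ (Amb m)) :=
  Module.nontrivial_of_finrank_pos (R := ℝ) (by rw [finrank_hyperplane]; omega)

/-- The Laplacian of the hyperplane `yᗮ` and the second derivative in the direction `y` add up to
the full Laplacian. -/
theorem sum_dirDeriv_hyperplane (y : Sph m) {κ : Type*} [Fintype κ]
    (b : OrthonormalBasis κ ℝ ((ℝ ∙ (y : Amb m))ᗮ : Submodule ℝ (Amb m))) (p : Poly m) :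
    dirDeriv (y : Amb m) (dirDeriv (y : Amb m) p) +
      ∑ j, dirDeriv (b j : Amb m) (dirDeriv (b j : Amb m) p) = polyLaplacian m p := by
  rw [← polyLaplacian_eq_sum_dirDeriv (fun k : Option κ => k.elim (y : Amb m) (fun j => (b j : Amb m)))]
  · rw [Fintype.sum_option]; rfl
  · intro x z
    rw [Fintype.sum_option]
    simp only [Option.elim]
    have hy : ‖(y : Amb m)‖ = 1 := norm_eq_of_mem_sphere y
    set P := ((ℝ ∙ (y : Amb m))ᗮ).orthogonalProjectionOnto with hP
    have hPx : ∀ x : Amb m, (P x : Amb m) = x - (inner ℝ (y : Amb m) x) • (y : Amb m) := by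
      intro x
      have := Submodule.starProjection_orthogonal_val (K := ℝ ∙ (y : Amb m)) x
      rw [Submodule.starProjection_unit_singleton ℝ hy] at this
      exact this
    have h1 : ∀ j (x : Amb m), inner ℝ (b j : Amb m) x = inner ℝ (b j) (P x) := by
      intro j x
      rw [Submodule.coe_inner, hPx, inner_sub_right, inner_smul_right,
        Submodule.mem_orthogonal_singleton_iff_inner_left.1 (b j).2]
      simp
    have h2 : ∑ j, inner ℝ x (b j : Amb m) * inner ℝ (b j : Amb m) z = inner ℝ (P x) (P z) := by
      rw [← b.sum_inner_mul_inner (P x) (P z)]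
      refine Finset.sum_congr rfl fun j _ => ?_
      rw [real_inner_comm, h1, h1, real_inner_comm (b j) (P x)]
    rw [h2, Submodule.coe_inner, hPx, hPx]
    simp only [inner_sub_left, inner_sub_right, inner_smul_left, inner_smul_right,
      real_inner_self_eq_norm_sq, hy, real_inner_comm (y : Amb m) x]
    simp

/-- A harmonic polynomial that vanishes at `y` has integral zero over the unit sphere of `yᗮ`. -/
theorem sphereInt_hyperplane_eq_zero (hm : 1 ≤ m) (y : Sph m) (n : ℕ) {Y : Poly m}
    (hY : Y ∈ harmPoly m n) (h0 : evalAt (y : Amb m) Y = 0) :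
    sphereInt (hyperplaneIncl y) Y = 0 := by
  induction n using Nat.strong_induction_on generalizing Y with
  | _ n ih =>
  rcases Nat.eq_zero_or_pos n with rfl | hn
  · obtain ⟨c, rfl⟩ := eq_C_of_mem_harmPoly_zero hY
    rw [evalAt_C] at h0
    subst h0
    simp [sphereInt]
  have := nontrivial_hyperplane hm y
  have hY' := mem_harmPoly.1 hY
  set D := dirDeriv (y : Amb m) with hD
  have hDD : D (D Y) ∈ harmPoly m (n - 1 - 1) :=
    dirDeriv_mem_harmPoly (dirDeriv_mem_harmPoly hY _) _
  have hDD0 : evalAt (y : Amb m) (D (D Y)) = 0 := by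
    rw [hD, evalAt_dirDeriv_self (isHomogeneous_dirDeriv hY'.1 _), evalAt_dirDeriv_self hY'.1, h0]
    simp
  have hz : gaussInt (hyperplaneIncl y) (D (D Y)) = 0 := by
    rw [gaussInt_eq_radialFactor_mul _ (mem_harmPoly.1 hDD).1, ih _ (by omega) hDD hDD0, mul_zero]
  have hg := sum_gaussInt_dirDeriv_mul (hyperplaneIncl y)
    (stdOrthonormalBasis ℝ ((ℝ ∙ (y : Amb m))ᗮ : Submodule ℝ (Amb m))) 1 hY'.1
  simp only [one_mul] at hg
  have hsum := sum_dirDeriv_hyperplane y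
    (stdOrthonormalBasis ℝ ((ℝ ∙ (y : Amb m))ᗮ : Submodule ℝ (Amb m))) Y
  have h3 := congrArg (gaussInt (hyperplaneIncl y)) hsum
  rw [hY'.2, gaussInt_add, hz, zero_add] at h3
  change gaussIntₗ (hyperplaneIncl y) _ = gaussIntₗ (hyperplaneIncl y) _ at h3
  rw [map_sum, map_zero] at h3
  have h4 : (n : ℂ) * gaussInt (hyperplaneIncl y) Y = 0 := by
    rw [← hg]; exact h3
  rw [gaussInt_eq_radialFactor_mul _ hY'.1] at h4
  have hn' : (n : ℂ) ≠ 0 := by exact_mod_cast hn.ne'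
  have hr : ((radialFactor (Module.finrank ℝ ((ℝ ∙ (y : Amb m))ᗮ : Submodule ℝ (Amb m))) n : ℝ) : ℂ) ≠ 0 := by
    exact_mod_cast (radialFactor_pos _ _).ne'
  simpa [hn', hr] using h4

/-- A harmonic polynomial `Y` that vanishes at `y` has integral zero over every rim centred at `y`:
the derivative of the integral in `t` is the integral of `∂_y Y`, which vanishes by induction on the
degree, so that the case `t = 0` suffices. -/
theorem integral_equator_eq_zero (hm : 1 ≤ m) (y : Sph m) (s : ℝ) (n : ℕ) {Y : Poly m}
    (hY : Y ∈ harmPoly m n) (h0 : evalAt (y : Amb m) Y = 0) (t : ℝ) :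
    ∫ u : Equator y, evalAt (t • (y : Amb m) + s • hyperplaneIncl y u) Y ∂(equatorMeasure y) = 0 := by
  induction n generalizing Y t with
  | zero =>
    obtain ⟨c, rfl⟩ := eq_C_of_mem_harmPoly_zero hY
    rw [evalAt_C] at h0
    subst h0
    simp
  | succ n ih =>
    have hY' := mem_harmPoly.1 hY
    have hcont : ∀ (p : Poly m) (t : ℝ), Continuous fun u : Equator y =>
        evalAt (t • (y : Amb m) + s • hyperplaneIncl y u) p := by
      intro p t
      refine (continuous_evalAt p).comp ?_
      fun_prop
    have hder : ∀ t, HasDerivAt (fun t : ℝ => ∫ u : Equator y,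
        evalAt (t • (y : Amb m) + s • hyperplaneIncl y u) Y ∂(equatorMeasure y)) 0 t := by
      intro t
      obtain ⟨c, a, hca⟩ := exists_norm_evalAt_le_exp (dirDeriv (y : Amb m) Y)
      have hc : 0 ≤ c := by simpa using (norm_nonneg _).trans (hca 0)
      have := hasDerivAt_integral_of_dominated_loc_of_deriv_le (μ := equatorMeasure y)
        (F := fun (t : ℝ) (u : Equator y) => evalAt (t • (y : Amb m) + s • hyperplaneIncl y u) Y)
        (F' := fun t u => evalAt (t • (y : Amb m) + s • hyperplaneIncl y u) (dirDeriv (y : Amb m) Y))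
        (bound := fun _ => c * Real.exp (|a| * (|t| + 1 + |s|))) (x₀ := t)
        (Metric.ball_mem_nhds t one_pos)
        (Eventually.of_forall fun t => (hcont Y t).aestronglyMeasurable)
        (integrable_of_continuous_of_compactSpace (hcont Y t))
        (hcont _ t).aestronglyMeasurable ?_ (integrable_const _) ?_
      · have h := this.2
        rwa [ih (dirDeriv_mem_harmPoly hY _)
          (by rw [evalAt_dirDeriv_self hY'.1, h0, mul_zero]) t] at h
      · refine Eventually.of_forall fun u τ hτ => (hca _).trans ?_
        refine mul_le_mul_of_nonneg_left (Real.exp_le_exp.2 ?_) hc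
        refine (mul_le_mul_of_nonneg_right (le_abs_self a) (norm_nonneg _)).trans ?_
        refine mul_le_mul_of_nonneg_left ((norm_add_le _ _).trans ?_) (abs_nonneg a)
        have hy : ‖(y : Amb m)‖ = 1 := norm_eq_of_mem_sphere y
        have hu : ‖(u : ((ℝ ∙ (y : Amb m))ᗮ : Submodule ℝ (Amb m)))‖ = 1 := norm_eq_of_mem_sphere u
        rw [norm_smul, norm_smul, LinearIsometry.norm_map, hy, hu, mul_one, mul_one,
          Real.norm_eq_abs, Real.norm_eq_abs]
        rw [Metric.mem_ball, Real.dist_eq] at hτ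
        have := abs_sub_abs_le_abs_sub τ t
        linarith
      · refine Eventually.of_forall fun u τ _ => ?_
        have h := hasLineDerivAt_evalAt LinearIsometry.id Y
          (τ • (y : Amb m) + s • hyperplaneIncl y u) (y : Amb m)
        have h' : HasDerivAt (fun r : ℝ => evalAt ((τ • (y : Amb m) + s • hyperplaneIncl y u) +
          r • (y : Amb m)) Y) (evalAt (τ • (y : Amb m) + s • hyperplaneIncl y u)
            (dirDeriv (y : Amb m) Y)) (τ - τ) := by rw [sub_self]; exact h
        have h2 := h'.comp_sub_const τ τ
        refine h2.congr_of_eventuallyEq (Eventually.of_forall fun r => ?_)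
        dsimp only
        congr 2
        rw [sub_smul]
        abel
    have hconst := is_const_of_deriv_eq_zero (fun t => (hder t).differentiableAt)
      (fun t => (hder t).deriv) t 0
    rw [hconst]
    have h5 := sphereInt_hyperplane_eq_zero hm y _ hY h0
    simp only [zero_smul, zero_add, evalAt_smul_point hY'.1]
    rw [integral_const_mul]
    unfold sphereInt at h5
    unfold equatorMeasure
    rw [h5, mul_zero]

theorem inner_rimPoint (y : Sph m) {t : ℝ} (h1 : -1 ≤ t) (h2 : t ≤ 1) (u : Equator y) :
    inner ℝ (y : Amb m) (rimPoint y t u : Amb m) = t := by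
  rw [rimPoint_coe y t h1 h2, inner_add_right, inner_smul_right, inner_smul_right,
    real_inner_self_eq_norm_sq, norm_eq_of_mem_sphere y,
    Submodule.mem_orthogonal_singleton_iff_inner_right.1
      (u : ((ℝ ∙ (y : Amb m))ᗮ : Submodule ℝ (Amb m))).2]
  simp

theorem continuous_rimPoint (y : Sph m) (t : ℝ) : Continuous (rimPoint y t) := by
  unfold rimPoint
  fun_prop

/-- The spherical means of a spherical harmonic `Y` of degree `n` are `S_t Y = P_n(t) Y`. -/
theorem shift_restrictSph (hm : 1 ≤ m) {n : ℕ} {Y : Poly m} (hY : Y ∈ harmPoly m n) (y : Sph m)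
    {t : ℝ} (h1 : -1 ≤ t) (h2 : t ≤ 1) :
    shift t (restrictSph m Y) y = legendreP m n t * restrictSph m Y y := by
  have := nontrivial_hyperplane hm y
  have hne : equatorMeasure y ≠ 0 := Measure.toSphere_ne_zero _
  have : NeZero (equatorMeasure y) := ⟨hne⟩
  have hy : ‖(y : Amb m)‖ = 1 := norm_eq_of_mem_sphere y
  set c := evalAt (y : Amb m) Y with hc
  have hZ : Y - c • zonal (y : Amb m) n ∈ harmPoly m n :=
    Submodule.sub_mem _ hY (Submodule.smul_mem _ _ (zonal_mem_harmPoly hm hy n))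
  have hZ0 : evalAt (y : Amb m) (Y - c • zonal (y : Amb m) n) = 0 := by
    rw [map_sub, evalAt_smul, evalAt_zonal hy, real_inner_self_eq_norm_sq, hy, one_pow,
      legendreP_one hm, ← hc]
    simp
  have h3 := integral_equator_eq_zero hm y (√(1 - t ^ 2)) n hZ hZ0 t
  have h4 : ∀ u : Equator y, evalAt (t • (y : Amb m) + √(1 - t ^ 2) • hyperplaneIncl y u)
      (Y - c • zonal (y : Amb m) n) = restrictSph m Y (rimPoint y t u) - c * legendreP m n t := by
    intro u
    have e : t • (y : Amb m) + √(1 - t ^ 2) • hyperplaneIncl y u = (rimPoint y t u : Amb m) :=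
      (rimPoint_coe y t h1 h2 u).symm
    rw [e, map_sub, evalAt_smul, evalAt_zonal (norm_eq_of_mem_sphere _), inner_rimPoint y h1 h2]
    rfl
  have hcont : Continuous fun u : Equator y => restrictSph m Y (rimPoint y t u) :=
    (continuous_evalAt Y).comp (continuous_subtype_val.comp (continuous_rimPoint y t))
  simp only [h4] at h3
  rw [integral_sub (integrable_of_continuous_of_compactSpace hcont)
    (integrable_const _), sub_eq_zero] at h3
  unfold shift
  rw [average_eq, h3, integral_const, smul_smul, inv_mul_cancel₀, one_smul, mul_comm]
  · rfl
  · exact (measureReal_univ_pos).ne'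

/-! ### Estimates for Legendre polynomials -/

theorem continuous_legendreP (m : ℕ) : ∀ n, Continuous (legendreP m n)
  | 0 => continuous_const
  | 1 => continuous_id
  | n + 2 => by
    have h1 := continuous_legendreP m (n + 1)
    have h0 := continuous_legendreP m n
    have h : legendreP m (n + 2) = fun t => ((2 * n + m + 1) * t * legendreP m (n + 1) t -
        (n + 1) * legendreP m n t) / (n + m) := by
      ext t
      rw [legendreP]
    rw [h]
    fun_prop

/-- `(2 n + m + 1) / (n + m) ≤ 2` and `(n + 1) / (n + m) ≤ 1`, so that the recurrence grows at most
geometrically. -/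
theorem abs_recurrence_le (hm : 1 ≤ m) (n : ℕ) (u v : ℝ) :
    |((2 * n + m + 1) * u - (n + 1) * v) / (n + m)| ≤ 2 * |u| + |v| := by
  have hm' : (1 : ℝ) ≤ m := by exact_mod_cast hm
  have hn : (0 : ℝ) ≤ n := by positivity
  rw [abs_div, abs_of_pos (show (0 : ℝ) < n + m by linarith), div_le_iff₀ (by linarith)]
  refine (abs_sub _ _).trans ?_
  rw [abs_mul, abs_mul, abs_of_pos (show (0 : ℝ) < 2 * n + m + 1 by linarith),
    abs_of_pos (show (0 : ℝ) < n + 1 by linarith)]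
  nlinarith [abs_nonneg u, abs_nonneg v, mul_nonneg (abs_nonneg u) (sub_nonneg.2 hm'),
    mul_nonneg (abs_nonneg v) (sub_nonneg.2 hm')]

theorem abs_legendreP_le (hm : 1 ≤ m) {t : ℝ} (ht : |t| ≤ 1) : ∀ n, |legendreP m n t| ≤ 3 ^ n
  | 0 => by simp [legendreP]
  | 1 => by simp [legendreP]; linarith
  | n + 2 => by
    have h1 := abs_legendreP_le hm ht (n + 1)
    have h0 := abs_legendreP_le hm ht n
    rw [legendreP, mul_assoc]
    refine (abs_recurrence_le hm n _ _).trans ?_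
    rw [abs_mul]
    have := mul_le_mul ht h1 (abs_nonneg _) zero_le_one
    have h3 : (0 : ℝ) < 3 ^ n := by positivity
    rw [pow_succ] at this
    rw [pow_add]
    linarith

/-- The quotient `(1 - P_n(t)) / (1 - t)`, a polynomial in `t`. -/
noncomputable def legendreQuot (m : ℕ) : ℕ → ℝ → ℝ
  | 0, _ => 0
  | 1, _ => 1
  | n + 2, t => ((2 * n + m + 1) * (1 + t * legendreQuot m (n + 1) t) -
      (n + 1) * legendreQuot m n t) / (n + m)

theorem one_sub_legendreP (hm : 1 ≤ m) (t : ℝ) :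
    ∀ n, 1 - legendreP m n t = (1 - t) * legendreQuot m n t
  | 0 => by simp [legendreP, legendreQuot]
  | 1 => by simp [legendreP, legendreQuot]
  | n + 2 => by
    have h1 := one_sub_legendreP hm t (n + 1)
    have h0 := one_sub_legendreP hm t n
    have : (n : ℝ) + m ≠ 0 := by positivity
    rw [legendreP, legendreQuot]
    field_simp
    linear_combination (2 * n + m + 1) * t * h1 - (n + 1) * h0

theorem continuous_legendreQuot (m : ℕ) : ∀ n, Continuous (legendreQuot m n)
  | 0 => continuous_const
  | 1 => continuous_const
  | n + 2 => by
    have h1 := continuous_legendreQuot m (n + 1)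
    have h0 := continuous_legendreQuot m n
    have h : legendreQuot m (n + 2) = fun t => ((2 * n + m + 1) *
        (1 + t * legendreQuot m (n + 1) t) - (n + 1) * legendreQuot m n t) / (n + m) := by
      ext t
      rw [legendreQuot]
    rw [h]
    fun_prop

theorem abs_legendreQuot_le (hm : 1 ≤ m) {t : ℝ} (ht : |t| ≤ 1) :
    ∀ n, |legendreQuot m n t| ≤ 4 ^ n
  | 0 => by simp [legendreQuot]
  | 1 => by simp [legendreQuot]
  | n + 2 => by
    have h1 := abs_legendreQuot_le hm ht (n + 1)
    have h0 := abs_legendreQuot_le hm ht n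
    rw [legendreQuot]
    refine (abs_recurrence_le hm n _ _).trans ?_
    have h2 : |1 + t * legendreQuot m (n + 1) t| ≤ 1 + 4 ^ (n + 1) := by
      refine (abs_add_le _ _).trans ?_
      rw [abs_one, abs_mul]
      have := mul_le_mul ht h1 (abs_nonneg _) zero_le_one
      linarith
    have h3 : (1 : ℝ) ≤ 4 ^ n := one_le_pow₀ (by norm_num)
    rw [pow_succ] at h2
    rw [pow_add]
    linarith

/-- The eigenvalue `P_n'(1)` of the Laplace-Beltrami derivative on spherical harmonics of degree
`n`. -/
noncomputable def lbEigenvalue (m n : ℕ) : ℝ := legendreQuot m n 1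

theorem abs_lbEigenvalue_le (hm : 1 ≤ m) (n : ℕ) : |lbEigenvalue m n| ≤ 4 ^ n :=
  abs_legendreQuot_le hm (by simp) n

theorem abs_inner_sph_le (x y : Sph m) : |inner ℝ (x : Amb m) (y : Amb m)| ≤ 1 := by
  have := abs_real_inner_le_norm (x : Amb m) (y : Amb m)
  rwa [norm_eq_of_mem_sphere, norm_eq_of_mem_sphere, one_mul] at this

/-! ### Zonal kernels with rapidly decreasing coefficients -/

/-- Coefficients that decay faster than every geometric sequence. -/
def RapidDecay (a : ℕ → ℝ) : Prop := ∀ R : ℝ, 0 < R → Summable fun n => |a n| * R ^ n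

theorem RapidDecay.mul {a b : ℕ → ℝ} {R : ℝ} (ha : RapidDecay a) (hR : 0 < R)
    (hb : ∀ n, |b n| ≤ R ^ n) : RapidDecay fun n => a n * b n := by
  intro S hS
  refine Summable.of_nonneg_of_le (fun n => by positivity) (fun n => ?_) (ha (R * S) (by positivity))
  rw [abs_mul, mul_pow, ← mul_assoc]
  gcongr
  exact hb n

theorem RapidDecay.mul_pow {a b : ℕ → ℝ} {R : ℝ} (ha : RapidDecay a) (hR : 0 < R)
    (hb : ∀ n, |b n| ≤ R ^ n) : ∀ r : ℕ, RapidDecay fun n => a n * b n ^ r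
  | 0 => by simpa using ha
  | r + 1 => by
    have := (ha.mul_pow hR hb r).mul hR hb
    simpa only [pow_succ, mul_assoc] using this

/-- The value `P_n(x · y)` of the zonal kernel of degree `n`. -/
noncomputable def legendreKernel (n : ℕ) (x y : Sph m) : ℂ :=
  (legendreP m n (inner ℝ (x : Amb m) (y : Amb m)) : ℝ)

/-- The kernel `∑ₙ aₙ P_n(x · y)`. -/
noncomputable def zonalKernel (a : ℕ → ℝ) (x y : Sph m) : ℂ :=
  ∑' n, (a n : ℂ) * legendreKernel n x y

theorem legendreKernel_eq_restrictSph (n : ℕ) (x y : Sph m) :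
    legendreKernel n x y = restrictSph m (zonal (x : Amb m) n) y := by
  rw [restrictSph_apply, evalAt_zonal (norm_eq_of_mem_sphere y)]; rfl

theorem norm_legendreKernel_le (hm : 1 ≤ m) (n : ℕ) (x y : Sph m) :
    ‖legendreKernel n x y‖ ≤ 3 ^ n := by
  rw [legendreKernel, Complex.norm_real]
  exact abs_legendreP_le hm (abs_inner_sph_le x y) n

theorem continuous_legendreKernel (n : ℕ) :
    Continuous fun p : Sph m × Sph m => legendreKernel n p.1 p.2 := by
  unfold legendreKernel
  refine Complex.continuous_ofReal.comp ((continuous_legendreP m n).comp ?_)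
  fun_prop

theorem norm_zonalKernel_term_le (hm : 1 ≤ m) (a : ℕ → ℝ) (n : ℕ) (x y : Sph m) :
    ‖(a n : ℂ) * legendreKernel n x y‖ ≤ |a n| * 3 ^ n := by
  rw [norm_mul, Complex.norm_real, Real.norm_eq_abs]
  gcongr
  exact norm_legendreKernel_le hm n x y

theorem hasSum_zonalKernel (hm : 1 ≤ m) {a : ℕ → ℝ} (ha : RapidDecay a) (x y : Sph m) :
    HasSum (fun n => (a n : ℂ) * legendreKernel n x y) (zonalKernel a x y) :=
  (Summable.of_norm_bounded (ha 3 (by norm_num))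
    fun n => norm_zonalKernel_term_le hm a n x y).hasSum

theorem continuous_zonalKernel (hm : 1 ≤ m) {a : ℕ → ℝ} (ha : RapidDecay a) :
    Continuous fun p : Sph m × Sph m => zonalKernel a p.1 p.2 := by
  unfold zonalKernel
  exact continuous_tsum (fun n => (continuous_legendreKernel n).const_mul _) (ha 3 (by norm_num))
    fun n p => norm_zonalKernel_term_le hm a n p.1 p.2

theorem memLp_of_continuous {X : Type*} [TopologicalSpace X] [CompactSpace X]
    [MeasurableSpace X] [OpensMeasurableSpace X] {μ : Measure X} [IsFiniteMeasure μ]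
    {f : X → ℂ} (hf : Continuous f) : MemLp f 2 μ := by
  obtain ⟨C, hC⟩ := isCompact_univ.exists_bound_of_continuousOn hf.continuousOn
  exact MemLp.of_bound hf.aestronglyMeasurable_of_compactSpace C
    (Eventually.of_forall fun x => hC x (Set.mem_univ x))

theorem shift_zonalKernel (hm : 1 ≤ m) {a : ℕ → ℝ} (ha : RapidDecay a) (x y : Sph m) {t : ℝ}
    (h1 : -1 ≤ t) (h2 : t ≤ 1) :
    HasSum (fun n => (a n : ℂ) * (legendreP m n t * legendreKernel n x y))
      (shift t (zonalKernel a x) y) := by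
  have hx : ‖(x : Amb m)‖ = 1 := norm_eq_of_mem_sphere x
  have hterm : ∀ n, (legendreP m n t * legendreKernel n x y : ℂ) =
      ⨍ u, legendreKernel n x (rimPoint y t u) ∂(equatorMeasure y) := by
    intro n
    have := shift_restrictSph hm (zonal_mem_harmPoly hm hx n) y h1 h2
    rw [legendreKernel_eq_restrictSph, ← this]
    unfold shift
    simp only [legendreKernel_eq_restrictSph]
  simp only [hterm]
  unfold shift average
  have hcont : ∀ n, Continuous fun u : Equator y => legendreKernel n x (rimPoint y t u) := fun n =>
    (continuous_legendreKernel n).comp (continuous_const.prodMk (continuous_rimPoint y t))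
  have := hasSum_integral_of_dominated_convergence
    (μ := ((equatorMeasure y) Set.univ)⁻¹ • equatorMeasure y)
    (F := fun n (u : Equator y) => (a n : ℂ) * legendreKernel n x (rimPoint y t u))
    (f := fun u => zonalKernel a x (rimPoint y t u))
    (fun n _ => |a n| * 3 ^ n) (fun n => ((hcont n).const_mul _).aestronglyMeasurable)
    (fun n => Eventually.of_forall fun u => norm_zonalKernel_term_le hm a n _ _)
    (Eventually.of_forall fun u => ha 3 (by norm_num)) (integrable_const _)
    (Eventually.of_forall fun u => hasSum_zonalKernel hm ha _ _)
  simpa only [integral_const_mul] using this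

theorem continuous_zonalKernel_right (hm : 1 ≤ m) {a : ℕ → ℝ} (ha : RapidDecay a) (x : Sph m) :
    Continuous (zonalKernel a x) := by
  have h : Continuous fun y : Sph m => (x, y) := by fun_prop
  have h2 := (continuous_zonalKernel hm ha).comp h
  simp only [Function.comp_def] at h2
  exact h2

theorem abs_mul_quot_sub_le (hm : 1 ≤ m) (a : ℕ → ℝ) {t : ℝ} (ht : |t| ≤ 1) (n : ℕ) :
    |a n| * |legendreQuot m n t - lbEigenvalue m n| * 3 ^ n ≤ 2 * (|a n| * 12 ^ n) := by
  have h1 := abs_legendreQuot_le hm ht n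
  have h2 := abs_lbEigenvalue_le hm n
  have h3 := abs_sub (legendreQuot m n t) (lbEigenvalue m n)
  have h4 : |legendreQuot m n t - lbEigenvalue m n| ≤ 2 * 4 ^ n := by linarith
  calc _ ≤ |a n| * (2 * 4 ^ n) * 3 ^ n := by gcongr
    _ = 2 * (|a n| * 12 ^ n) := by
      rw [show (12 : ℝ) = 4 * 3 by norm_num, _root_.mul_pow]; ring

/-- A uniform bound for the error of the difference quotients of a zonal kernel. -/
noncomputable def quotError (m : ℕ) (a : ℕ → ℝ) (t : ℝ) : ℝ :=
  ∑' n, |a n| * |legendreQuot m n t - lbEigenvalue m n| * 3 ^ n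

theorem tendsto_quotError (hm : 1 ≤ m) {a : ℕ → ℝ} (ha : RapidDecay a) :
    Tendsto (quotError m a) (𝓝[<] 1) (𝓝 0) := by
  have := tendsto_tsum_of_dominated_convergence (𝓕 := 𝓝[<] (1 : ℝ))
    (f := fun t n => |a n| * |legendreQuot m n t - lbEigenvalue m n| * (3 : ℝ) ^ n)
    (g := fun _ => (0 : ℝ)) ((ha 12 (by norm_num)).mul_left 2) (fun n => ?_) ?_
  · rw [tsum_zero] at this
    exact this
  · have hc : Tendsto (fun t => |a n| * |legendreQuot m n t - lbEigenvalue m n| * (3 : ℝ) ^ n)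
        (𝓝 1) (𝓝 (|a n| * |legendreQuot m n 1 - lbEigenvalue m n| * (3 : ℝ) ^ n)) :=
      Continuous.tendsto (by have := continuous_legendreQuot m n; fun_prop) 1
    rw [lbEigenvalue, sub_self, abs_zero, mul_zero, zero_mul] at hc
    exact hc.mono_left nhdsWithin_le_nhds
  · filter_upwards [Ioo_mem_nhdsLT one_pos] with t ht n
    rw [Real.norm_of_nonneg (by positivity)]
    exact abs_mul_quot_sub_le hm a (by rw [abs_of_pos ht.1]; exact ht.2.le) n

theorem norm_quot_sub_le (hm : 1 ≤ m) {a : ℕ → ℝ} (ha : RapidDecay a) (x y : Sph m) {t : ℝ}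
    (ht : t ∈ Set.Ioo (0 : ℝ) 1) :
    ‖(zonalKernel a x y - shift t (zonalKernel a x) y) / ((1 - t : ℝ) : ℂ) -
      zonalKernel (fun n => a n * lbEigenvalue m n) x y‖ ≤ quotError m a t := by
  have hb : RapidDecay fun n => a n * lbEigenvalue m n :=
    ha.mul (by norm_num) (abs_lbEigenvalue_le hm)
  have ht1 : ((1 - t : ℝ) : ℂ) ≠ 0 := by
    have : (1 - t : ℝ) ≠ 0 := by linarith [ht.2]
    exact_mod_cast this
  have hs := (((hasSum_zonalKernel hm ha x y).sub
    (shift_zonalKernel hm ha x y (by linarith [ht.1]) ht.2.le)).div_const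
      ((1 - t : ℝ) : ℂ)).sub (hasSum_zonalKernel hm hb x y)
  have hterm : ∀ n, ((a n : ℂ) * legendreKernel n x y -
      (a n : ℂ) * (legendreP m n t * legendreKernel n x y)) / ((1 - t : ℝ) : ℂ) -
      ((a n * lbEigenvalue m n : ℝ) : ℂ) * legendreKernel n x y =
      ((a n * (legendreQuot m n t - lbEigenvalue m n) : ℝ) : ℂ) * legendreKernel n x y := by
    intro n
    have := congrArg (Complex.ofReal) (one_sub_legendreP hm t n)
    push_cast at this ht1 ⊢
    field_simp
    linear_combination (a n : ℂ) * legendreKernel n x y * this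
  simp only [hterm] at hs
  refine hs.norm_le_of_bounded ((Summable.of_nonneg_of_le (fun n => by positivity)
    (abs_mul_quot_sub_le hm a (by rw [abs_of_pos ht.1]; exact ht.2.le))
    ((ha 12 (by norm_num)).mul_left 2)).hasSum) fun n => ?_
  rw [norm_mul, Complex.norm_real, Real.norm_eq_abs, abs_mul]
  gcongr
  exact norm_legendreKernel_le hm n x y

/-- The Laplace-Beltrami derivative acts on zonal kernels through their coefficients. -/
theorem isLBDeriv_zonalKernel (hm : 1 ≤ m) {a : ℕ → ℝ} (ha : RapidDecay a) (x : Sph m) :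
    IsLBDeriv (zonalKernel a x) (zonalKernel (fun n => a n * lbEigenvalue m n) x) := by
  have hb : RapidDecay fun n => a n * lbEigenvalue m n :=
    ha.mul (by norm_num) (abs_lbEigenvalue_le hm)
  refine ⟨memLp_of_continuous (continuous_zonalKernel_right hm ha x),
    memLp_of_continuous (continuous_zonalKernel_right hm hb x), ?_⟩
  have hupper : Tendsto (fun t => (surf m Set.univ) ^ ((2 : ENNReal).toReal)⁻¹ *
      ENNReal.ofReal (quotError m a t)) (𝓝[<] 1) (𝓝 0) := by
    have h := ENNReal.Tendsto.const_mul (a := (surf m Set.univ) ^ ((2 : ENNReal).toReal)⁻¹)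
      (ENNReal.tendsto_ofReal (tendsto_quotError hm ha))
      (Or.inr (ENNReal.rpow_ne_top_of_nonneg (by norm_num) (measure_ne_top _ _)))
    simpa using h
  refine tendsto_of_tendsto_of_tendsto_of_le_of_le' tendsto_const_nhds hupper
    (Eventually.of_forall fun _ => zero_le) ?_
  filter_upwards [Ioo_mem_nhdsLT one_pos] with t ht
  exact eLpNorm_le_of_ae_bound (Eventually.of_forall fun y => norm_quot_sub_le hm ha x y ht)

theorem isLBDerivOfOrder_zero {f g : Sph m → ℂ} :
    IsLBDerivOfOrder 0 f g ↔ MemLp f 2 (surf m) ∧ g =ᵐ[surf m] f := Iff.rfl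

theorem isLBDerivOfOrder_succ {r : ℕ} {f g : Sph m → ℂ} :
    IsLBDerivOfOrder (r + 1) f g ↔ ∃ h, IsLBDerivOfOrder r f h ∧ IsLBDeriv h g := Iff.rfl

theorem isLBDerivOfOrder_zonalKernel (hm : 1 ≤ m) {a : ℕ → ℝ} (ha : RapidDecay a) (x : Sph m)
    (r : ℕ) : IsLBDerivOfOrder r (zonalKernel a x)
      (zonalKernel (fun n => a n * lbEigenvalue m n ^ r) x) := by
  induction r with
  | zero =>
    rw [isLBDerivOfOrder_zero]
    simp only [pow_zero, mul_one]
    exact ⟨memLp_of_continuous (continuous_zonalKernel_right hm ha x), EventuallyEq.rfl⟩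
  | succ r ih =>
    rw [isLBDerivOfOrder_succ]
    have := isLBDeriv_zonalKernel hm (ha.mul_pow (by norm_num) (abs_lbEigenvalue_le hm) r) x
    simp only [mul_assoc, ← pow_succ] at this
    exact ⟨_, ih, this⟩

/-! ### Integral operators with continuous kernels -/

theorem exists_isIntegralOperator {K : Sph m → Sph m → ℂ}
    (hK : Continuous fun p : Sph m × Sph m => K p.1 p.2) :
    ∃ T : L2Sph m →L[ℂ] L2Sph m, IsIntegralOperator K T := by
  obtain ⟨C, hC⟩ := isCompact_univ.exists_bound_of_continuousOn hK.continuousOn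
  have hC' : ∀ x y, ‖K x y‖ ≤ C := fun x y => hC (x, y) (Set.mem_univ _)
  have hKx : ∀ x, Continuous (K x) := fun x => hK.comp (continuous_const.prodMk continuous_id)
  have hf1 : ∀ f : L2Sph m, Integrable f (surf m) := fun f => (Lp.memLp f).integrable one_le_two
  have hint : ∀ (f : L2Sph m) x, Integrable (fun y => K x y * f y) (surf m) := fun f x =>
    (hf1 f).bdd_mul (hKx x).aestronglyMeasurable (Eventually.of_forall (hC' x))
  have hcont : ∀ f : L2Sph m, Continuous fun x => ∫ y, K x y * f y ∂(surf m) := by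
    intro f
    refine continuous_of_dominated (bound := fun y => C * ‖f y‖)
      (fun x => (hint f x).aestronglyMeasurable)
      (fun x => Eventually.of_forall fun y => ?_) ((hf1 f).norm.const_mul C)
      (Eventually.of_forall fun y => ?_)
    · rw [norm_mul]
      gcongr
      exact hC' x y
    · exact (hK.comp (continuous_id.prodMk continuous_const)).mul continuous_const
  let L : L2Sph m →ₗ[ℂ] C(Sph m, ℂ) :=
    { toFun := fun f => ⟨fun x => ∫ y, K x y * f y ∂(surf m), hcont f⟩
      map_add' := fun f g => by
        ext x
        simp only [ContinuousMap.coe_mk, ContinuousMap.add_apply]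
        rw [← integral_add (hint f x) (hint g x)]
        refine integral_congr_ae ?_
        filter_upwards [Lp.coeFn_add f g] with y hy
        rw [hy, Pi.add_apply, mul_add]
      map_smul' := fun c f => by
        ext x
        simp only [ContinuousMap.coe_mk, ContinuousMap.smul_apply, RingHom.id_apply]
        rw [← integral_smul]
        refine integral_congr_ae ?_
        filter_upwards [Lp.coeFn_smul c f] with y hy
        rw [hy, Pi.smul_apply, smul_eq_mul, smul_eq_mul]
        ring }
  have hC0 : 0 ≤ |C| := abs_nonneg C
  set M : ℝ := ((surf m) Set.univ ^ (1 / (1 : ENNReal).toReal - 1 / (2 : ENNReal).toReal)).toReal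
    with hM
  have hL : ∀ f, ‖L f‖ ≤ (|C| * M) * ‖f‖ := by
    intro f
    refine (ContinuousMap.norm_le _ (by positivity)).2 fun x => ?_
    have h1 : ‖∫ y, K x y * f y ∂(surf m)‖ ≤ |C| * ∫ y, ‖f y‖ ∂(surf m) := by
      rw [← integral_const_mul]
      refine norm_integral_le_of_norm_le ((hf1 f).norm.const_mul _) (Eventually.of_forall fun y => ?_)
      rw [norm_mul]
      gcongr
      exact (hC' x y).trans (le_abs_self C)
    refine h1.trans ?_
    rw [mul_assoc]
    refine mul_le_mul_of_nonneg_left ?_ hC0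
    have h2 := eLpNorm_le_eLpNorm_mul_rpow_measure_univ (p := 1) (q := 2) one_le_two
      (Lp.aestronglyMeasurable f)
    rw [integral_norm_eq_lintegral_enorm (Lp.aestronglyMeasurable f), ← eLpNorm_one_eq_lintegral_enorm,
      Lp.norm_def, hM, mul_comm, ← ENNReal.toReal_mul]
    refine ENNReal.toReal_mono ?_ h2
    refine ENNReal.mul_ne_top (Lp.eLpNorm_ne_top f)
      (ENNReal.rpow_ne_top_of_nonneg (by norm_num) (measure_ne_top _ _))
  refine ⟨(ContinuousMap.toLp 2 (surf m) ℂ).comp (L.mkContinuous _ hL), fun f => ?_⟩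
  filter_upwards [ContinuousMap.coeFn_toLp (p := 2) (𝕜 := ℂ) (surf m) (L f)] with x hx
  exact ⟨hint f x, hx⟩

/-! ### Operators that are diagonal along an orthogonal decomposition -/

section Hilbert

variable {H : Type*} [NormedAddCommGroup H] [InnerProductSpace ℂ H] {V : ℕ → Submodule ℂ H}

theorem finiteDimensional_biSup [∀ n, FiniteDimensional ℂ (V n)] (I : Finset ℕ) :
    FiniteDimensional ℂ (⨆ n ∈ I, V n : Submodule ℂ H) := by
  rw [← Finset.sup_eq_iSup]
  exact Submodule.finiteDimensional_finset_sup I V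

theorem finrank_iSup_of_orthogonal
    (horth : ∀ i j, i ≠ j → ∀ u ∈ V i, ∀ v ∈ V j, inner ℂ u v = 0)
    [∀ n, FiniteDimensional ℂ (V n)] (I : Finset ℕ) :
    Module.finrank ℂ (⨆ n ∈ I, V n : Submodule ℂ H) = ∑ n ∈ I, Module.finrank ℂ (V n) := by
  classical
  induction I using Finset.induction_on with
  | empty => rw [show (⨆ n ∈ (∅ : Finset ℕ), V n) = ⊥ by simp, finrank_bot, Finset.sum_empty]
  | insert a s ha ih =>
    rw [Finset.iSup_insert, Finset.sum_insert ha, ← ih]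
    have := finiteDimensional_biSup (V := V) s
    have hdisj : V a ⊓ (⨆ n ∈ s, V n) = ⊥ := by
      rw [Submodule.eq_bot_iff]
      rintro x ⟨hx1, hx2⟩
      have hle : (⨆ n ∈ s, V n) ≤ (V a)ᗮ := by
        refine iSup₂_le fun k hk u hu => (Submodule.mem_orthogonal _ _).2 fun v hv => ?_
        exact horth a k (by rintro rfl; exact ha hk) v hv u hu
      exact inner_self_eq_zero.1 ((Submodule.mem_orthogonal _ _).1 (hle hx2) x hx1)
    have := Submodule.finrank_sup_add_finrank_inf_eq (V a) (⨆ n ∈ s, V n)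
    rwa [hdisj, finrank_bot, add_zero] at this

/-- The subspaces `V n` are pairwise orthogonal, only `0` is orthogonal to all of them, and `T` is
multiplication by `c n ≥ 0` on `V n`. -/
structure IsDiagonal (V : ℕ → Submodule ℂ H) (T : H →L[ℂ] H) (c : ℕ → ℝ) : Prop where
  orthogonal : ∀ i j, i ≠ j → ∀ u ∈ V i, ∀ v ∈ V j, inner ℂ u v = 0
  total : ∀ x, (∀ n, ∀ v ∈ V n, inner ℂ v x = 0) → x = 0
  nonneg : ∀ n, 0 ≤ c n
  apply_eq : ∀ n, ∀ v ∈ V n, T v = (c n : ℂ) • v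

variable [CompleteSpace H] {T : H →L[ℂ] H} {c : ℕ → ℝ}

theorem IsDiagonal.adjoint_eq (h : IsDiagonal V T c) : ContinuousLinearMap.adjoint T = T := by
  have h1 : ∀ n, ∀ v ∈ V n, ContinuousLinearMap.adjoint T v = (c n : ℂ) • v := by
    intro n v hv
    rw [← sub_eq_zero]
    refine h.total _ fun k u hu => ?_
    rw [inner_sub_right, ContinuousLinearMap.adjoint_inner_right, h.apply_eq k u hu,
      inner_smul_left, inner_smul_right, Complex.conj_ofReal]
    rcases eq_or_ne k n with rfl | hkn
    · simp
    · simp [h.orthogonal k n hkn u hu v hv]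
  ext x
  rw [← sub_eq_zero]
  refine h.total _ fun k u hu => ?_
  rw [inner_sub_right, ContinuousLinearMap.adjoint_inner_right, h.apply_eq k u hu,
    ← ContinuousLinearMap.adjoint_inner_left, h1 k u hu, sub_self]

theorem IsDiagonal.inner_map_comm (h : IsDiagonal V T c) (x y : H) :
    inner ℂ (T x) y = inner ℂ x (T y) := by
  rw [← ContinuousLinearMap.adjoint_inner_right, h.adjoint_eq]

theorem IsDiagonal.isPositive (h : IsDiagonal V T c) : T.IsPositive := by
  refine ContinuousLinearMap.isPositive_def.2 ⟨fun x y => h.inner_map_comm x y, fun x => ?_⟩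
  have hdense : Dense ((⨆ n, V n : Submodule ℂ H) : Set H) := by
    rw [Submodule.dense_iff_topologicalClosure_eq_top, Submodule.topologicalClosure_eq_top_iff,
      Submodule.eq_bot_iff]
    intro y hy
    refine h.total y fun n v hv => ?_
    exact (Submodule.mem_orthogonal _ _).1 hy v (Submodule.mem_iSup_of_mem n hv)
  have hclosed : IsClosed {x | 0 ≤ T.reApplyInnerSelf x} :=
    isClosed_le continuous_const T.reApplyInnerSelf_continuous
  refine hclosed.closure_subset_iff.2 ?_ (hdense x)
  intro y hy
  obtain ⟨f, hf, rfl⟩ := (Submodule.mem_iSup_iff_exists_finsupp _ _).1 hy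
  change 0 ≤ RCLike.re (inner ℂ (T _) _)
  rw [Finsupp.sum, map_sum, sum_inner]
  rw [map_sum]
  refine Finset.sum_nonneg fun i _ => ?_
  rw [inner_sum, map_sum]
  refine Finset.sum_nonneg fun j _ => ?_
  rw [h.apply_eq i _ (hf i), inner_smul_left, Complex.conj_ofReal]
  rcases eq_or_ne i j with rfl | hij
  · rw [inner_self_eq_norm_sq_to_K]
    have := h.nonneg i
    rw [← RCLike.ofReal_pow, ← Complex.coe_algebraMap]
    change 0 ≤ RCLike.re (((c i : ℝ) : ℂ) * ((‖f i‖ ^ 2 : ℝ) : ℂ))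
    rw [← Complex.ofReal_mul]
    change 0 ≤ ((c i * ‖f i‖ ^ 2 : ℝ) : ℂ).re
    rw [Complex.ofReal_re]
    positivity
  · rw [h.orthogonal i j hij _ (hf i) _ (hf j)]; simp

/-- An eigenvector is orthogonal to `V n` unless `c n` is its eigenvalue, so its component off
`⨆ n ∈ I, V n` is orthogonal to every `V n`. -/
theorem IsDiagonal.eigenspace_eq (h : IsDiagonal V T c) [∀ n, FiniteDimensional ℂ (V n)]
    (μ : ℝ) (I : Finset ℕ) (hI : ∀ n, n ∈ I ↔ c n = μ) :
    Module.End.eigenspace (T : H →ₗ[ℂ] H) (μ : ℂ) = ⨆ n ∈ I, V n := by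
  apply le_antisymm
  · intro x hx
    rw [Module.End.mem_eigenspace_iff] at hx
    have hx' : T x = (μ : ℂ) • x := hx
    have horth : ∀ n, n ∉ I → ∀ v ∈ V n, inner ℂ v x = 0 := by
      intro n hn v hv
      have h1 := h.inner_map_comm v x
      rw [h.apply_eq n v hv, hx', inner_smul_left, inner_smul_right, Complex.conj_ofReal,
        ← sub_eq_zero, ← sub_mul] at h1
      refine (mul_eq_zero.1 h1).resolve_left ?_
      rw [sub_eq_zero]
      exact_mod_cast fun h2 => hn ((hI n).2 h2)
    set W : Submodule ℂ H := ⨆ n ∈ I, V n with hW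
    have hWfin : FiniteDimensional ℂ W := finiteDimensional_biSup I
    have hWle : ∀ n ∈ I, V n ≤ W := fun n hn => le_iSup₂_of_le n hn le_rfl
    have hzero : x - W.starProjection x = 0 := by
      refine h.total _ fun n v hv => ?_
      by_cases hn : n ∈ I
      · exact (Submodule.mem_orthogonal _ _).1 (W.sub_starProjection_mem_orthogonal x) v (hWle n hn hv)
      · rw [inner_sub_right, horth n hn v hv, zero_sub, neg_eq_zero]
        have hle : W ≤ (V n)ᗮ := by
          refine iSup₂_le fun k hk u hu => (Submodule.mem_orthogonal _ _).2 fun v hv => ?_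
          exact h.orthogonal n k (by rintro rfl; exact hn hk) v hv u hu
        exact (Submodule.mem_orthogonal _ _).1 (hle (W.starProjection_apply_mem x)) v hv
    rw [sub_eq_zero] at hzero
    rw [hzero]
    exact W.starProjection_apply_mem x
  · refine iSup₂_le fun n hn v hv => ?_
    rw [Module.End.mem_eigenspace_iff, ← (hI n).1 hn]
    exact h.apply_eq n v hv

end Hilbert

/-! ### Spherical harmonics in `L²` -/

/-- Restriction of polynomials to the sphere, as continuous functions. -/
noncomputable def polyC (m : ℕ) : Poly m →ₐ[ℂ] C(Sph m, ℂ) :=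
  aeval fun i => ⟨fun x : Sph m => (((x : Amb m) i : ℝ) : ℂ), by fun_prop⟩

theorem polyC_apply (p : Poly m) (x : Sph m) : polyC m p x = evalAt (x : Amb m) p := by
  induction p using MvPolynomial.induction_on with
  | C z => rw [polyC, aeval_C, evalAt_C]; simp
  | add p q hp hq => simp [hp, hq]
  | mul_X p i hp =>
    rw [map_mul, ContinuousMap.mul_apply, hp, map_mul, evalAt_X]
    simp [polyC]

/-- Restriction of polynomials to the sphere, as elements of `L²`. -/
noncomputable def polyL2 (m : ℕ) : Poly m →ₗ[ℂ] L2Sph m :=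
  (ContinuousMap.toLp 2 (surf m) ℂ : C(Sph m, ℂ) →L[ℂ] L2Sph m).toLinearMap ∘ₗ
    (polyC m).toLinearMap

/-- The space of spherical harmonics of degree `n` as a subspace of `L²`. -/
noncomputable def harmL2 (m n : ℕ) : Submodule ℂ (L2Sph m) := (harmPoly m n).map (polyL2 m)

instance : (surf m).IsOpenPosMeasure := by unfold surf; infer_instance

theorem polyL2_coeFn (p : Poly m) :
    polyL2 m p =ᵐ[surf m] fun x : Sph m => evalAt (x : Amb m) p := by
  refine (ContinuousMap.coeFn_toLp (p := 2) (𝕜 := ℂ) (surf m) (polyC m p)).trans ?_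
  exact Eventually.of_forall fun x => polyC_apply p x

theorem polyL2_eq_iff {p q : Poly m} : polyL2 m p = polyL2 m q ↔ restrictSph m p = restrictSph m q := by
  have h : polyL2 m p = polyL2 m q ↔ polyC m p = polyC m q :=
    (ContinuousMap.toLp_injective (surf m) (p := 2) (𝕜 := ℂ)).eq_iff
  rw [h, ContinuousMap.ext_iff, funext_iff]
  simp only [polyC_apply, restrictSph_apply]

instance finiteDimensional_harmPoly (n : ℕ) : FiniteDimensional ℂ (harmPoly m n) := by
  have h : harmPoly m n ≤ restrictTotalDegree (Fin (m + 1)) ℂ n := by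
    intro p hp
    rw [mem_restrictTotalDegree]
    exact (mem_harmPoly.1 hp).1.totalDegree_le
  exact Submodule.finiteDimensional_of_le h

instance finiteDimensional_harmL2 (n : ℕ) : FiniteDimensional ℂ (harmL2 m n) := by
  unfold harmL2; infer_instance

/-- The surface measure charges every open set, so passing from functions to classes in `L²` loses
nothing. -/
theorem finrank_harmL2 (n : ℕ) : Module.finrank ℂ (harmL2 m n) = dimHarm m n := by
  unfold dimHarm
  rw [sphericalHarmonics_eq, harmL2]
  have h1 := LinearMap.finrank_range_add_finrank_ker ((polyL2 m).domRestrict (harmPoly m n))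
  have h2 := LinearMap.finrank_range_add_finrank_ker ((restrictSph m).domRestrict (harmPoly m n))
  have hker : LinearMap.ker ((polyL2 m).domRestrict (harmPoly m n)) =
      LinearMap.ker ((restrictSph m).domRestrict (harmPoly m n)) := by
    ext p
    have := polyL2_eq_iff (p := (p : Poly m)) (q := 0)
    rw [map_zero, map_zero] at this
    rw [LinearMap.mem_ker, LinearMap.mem_ker]
    exact this
  rw [LinearMap.range_domRestrict] at h1 h2
  rw [hker] at h1
  exact Nat.add_right_cancel (h1.trans h2.symm)

/-- The polynomial with conjugate coefficients. -/
noncomputable def conjPoly (p : Poly m) : Poly m := MvPolynomial.map (starRingEnd ℂ) p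

theorem evalAt_conjPoly (x : Amb m) (p : Poly m) :
    evalAt x (conjPoly p) = starRingEnd ℂ (evalAt x p) := by
  unfold conjPoly
  induction p using MvPolynomial.induction_on with
  | C z => simp
  | add p q hp hq => simp [hp, hq]
  | mul_X p i hp => simp [hp]

theorem conjPoly_mem_harmPoly {n : ℕ} {p : Poly m} (hp : p ∈ harmPoly m n) :
    conjPoly p ∈ harmPoly m n := by
  rw [mem_harmPoly] at hp ⊢
  refine ⟨hp.1.map _, ?_⟩
  have := congrArg (MvPolynomial.map (starRingEnd ℂ)) hp.2
  rw [polyLaplacian_apply, map_sum, map_zero] at this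
  rw [polyLaplacian_apply, ← this]
  refine Finset.sum_congr rfl fun i _ => ?_
  rw [← pderiv_map, ← pderiv_map]
  rfl

theorem inner_polyL2 (p q : Poly m) :
    inner ℂ (polyL2 m p) (polyL2 m q) = sphInt (conjPoly p * q) := by
  refine (ContinuousMap.inner_toLp (surf m) (polyC m p) (polyC m q)).trans ?_
  unfold sphInt
  refine integral_congr_ae (Eventually.of_forall fun x => ?_)
  simp only [polyC_apply, map_mul, evalAt_conjPoly]
  ring

theorem harmL2_orthogonal (i j : ℕ) (hij : i ≠ j) :
    ∀ u ∈ harmL2 m i, ∀ v ∈ harmL2 m j, inner ℂ u v = 0 := by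
  rintro _ ⟨p, hp, rfl⟩ _ ⟨q, hq, rfl⟩
  rw [inner_polyL2]
  exact sphInt_mul_eq_zero hij (conjPoly_mem_harmPoly hp) hq

theorem dense_range_polyC : Dense (Set.range (polyC m)) := by
  let A : StarSubalgebra ℂ C(Sph m, ℂ) :=
    { (polyC m).range with
      star_mem' := by
        rintro _ ⟨p, rfl⟩
        refine ⟨conjPoly p, ?_⟩
        ext x
        change polyC m (conjPoly p) x = starRingEnd ℂ (polyC m p x)
        rw [polyC_apply, polyC_apply, evalAt_conjPoly] }
  have hA : A.SeparatesPoints := by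
    intro x y hxy
    obtain ⟨i, hi⟩ : ∃ i, (x : Amb m) i ≠ (y : Amb m) i := by
      by_contra! h
      exact hxy (Subtype.ext (PiLp.ext h))
    refine ⟨_, ⟨polyC m (X i), ⟨X i, rfl⟩, rfl⟩, ?_⟩
    change polyC m (X i) x ≠ polyC m (X i) y
    rw [polyC_apply, polyC_apply, evalAt_X, evalAt_X]
    exact_mod_cast hi
  have h := ContinuousMap.starSubalgebra_topologicalClosure_eq_top_of_separatesPoints A hA
  have h2 : (A.topologicalClosure : Set C(Sph m, ℂ)) = Set.univ := by rw [h]; rfl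
  rw [StarSubalgebra.topologicalClosure_coe] at h2
  exact dense_iff_closure_eq.2 h2

theorem polyL2_mem_biSup (hm : 2 ≤ m) {n : ℕ} {p : Poly m} (hp : p.totalDegree < n) :
    polyL2 m p ∈ ⨆ j ∈ Finset.range n, harmL2 m j := by
  have h := restrictSph_mem_harmonicsBelow hm hp
  unfold harmonicsBelow at h
  simp only [sphericalHarmonics_eq] at h
  rw [← Submodule.map_iSup] at h
  obtain ⟨q, hq, hqp⟩ := h
  have h2 := Submodule.mem_map_of_mem (f := polyL2 m) hq
  rw [Submodule.map_iSup, polyL2_eq_iff.2 hqp] at h2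
  have hle : (⨆ j : Fin n, (harmPoly m j).map (polyL2 m)) ≤ ⨆ j ∈ Finset.range n, harmL2 m j :=
    iSup_le fun j => le_iSup₂_of_le (j : ℕ) (Finset.mem_range.2 j.2) le_rfl
  exact hle h2

/-- Spherical harmonics are complete in `L²`. -/
theorem harmL2_total (hm : 2 ≤ m) (f : L2Sph m)
    (hf : ∀ n, ∀ v ∈ harmL2 m n, inner ℂ v f = 0) : f = 0 := by
  have hdense : Dense (Set.range (polyL2 m)) := by
    have h1 : DenseRange (ContinuousMap.toLp 2 (surf m) ℂ : C(Sph m, ℂ) →L[ℂ] L2Sph m) :=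
      ContinuousMap.toLp_denseRange ℂ (surf m) ℂ (by norm_num)
    have h2 := h1.dense_image (ContinuousMap.toLp 2 (surf m) ℂ).continuous dense_range_polyC
    rwa [← Set.range_comp] at h2
  have hle : (⨆ n, harmL2 m n) ≤ (ℂ ∙ f)ᗮ := by
    refine iSup_le fun n v hv => Submodule.mem_orthogonal_singleton_iff_inner_left.2 (hf n v hv)
  refine hdense.eq_zero_of_inner_right ℂ ?_
  rintro _ ⟨p, rfl⟩
  have hle' : (⨆ j ∈ Finset.range (p.totalDegree + 1), harmL2 m j) ≤ (ℂ ∙ f)ᗮ :=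
    (iSup₂_le_iSup _ _).trans hle
  exact Submodule.mem_orthogonal_singleton_iff_inner_left.1
    (hle' (polyL2_mem_biSup hm (Nat.lt_succ_self p.totalDegree)))

/-! ### The addition formula -/

theorem conjPoly_zonal_eval (w y : Sph m) (n : ℕ) :
    evalAt (y : Amb m) (conjPoly (zonal (w : Amb m) n)) = evalAt (y : Amb m) (zonal (w : Amb m) n) := by
  rw [evalAt_conjPoly, evalAt_zonal (norm_eq_of_mem_sphere y), Complex.conj_ofReal]

theorem inner_polyL2_zonal (w : Sph m) (n : ℕ) (q : Poly m) :
    inner ℂ (polyL2 m (zonal (w : Amb m) n)) (polyL2 m q) = sphInt (zonal (w : Amb m) n * q) := by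
  rw [inner_polyL2]
  unfold sphInt
  simp only [map_mul, conjPoly_zonal_eval]

/-- The zonal polynomials reproduce the harmonic polynomials, with the constant `|S^m| / d_n`
that is found by taking the trace of the reproducing kernel. -/
theorem sphInt_zonal_mul (hm : 2 ≤ m) (n : ℕ) :
    0 < dimHarm m n ∧ ∀ w : Amb m, ‖w‖ = 1 → ∀ Y ∈ harmPoly m n,
      sphInt (zonal w n * Y) = (((surf m).real Set.univ / dimHarm m n : ℝ) : ℂ) * evalAt w Y := by
  have hm1 : 1 ≤ m := by omega
  obtain ⟨k, hk⟩ := exists_sphInt_zonal_mul hm1 n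
  have hzw : ∀ w : Sph m, ‖(w : Amb m)‖ = 1 := norm_eq_of_mem_sphere
  have hZ : ∀ w : Sph m, polyL2 m (zonal (w : Amb m) n) ∈ harmL2 m n := fun w =>
    ⟨_, zonal_mem_harmPoly hm1 (hzw w) n, rfl⟩
  have hself : ∀ w : Sph m, ((‖polyL2 m (zonal (w : Amb m) n)‖ ^ 2 : ℝ) : ℂ) = k := by
    intro w
    have h := inner_self_eq_norm_sq_to_K (𝕜 := ℂ) (polyL2 m (zonal (w : Amb m) n))
    rw [inner_polyL2_zonal, hk _ (hzw w) _ (zonal_mem_harmPoly hm1 (hzw w) n),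
      evalAt_zonal (hzw w), real_inner_self_eq_norm_sq, hzw w, one_pow, legendreP_one hm1] at h
    push_cast at h ⊢
    rw [mul_one] at h
    exact h.symm
  have hk0 : k ≠ 0 := by
    intro h0
    obtain ⟨w⟩ : Nonempty (Sph m) := ⟨⟨EuclideanSpace.single 0 1, by simp⟩⟩
    have h := hself w
    rw [h0] at h
    have h1 : polyL2 m (zonal (w : Amb m) n) = polyL2 m 0 := by
      rw [map_zero]
      have : ‖polyL2 m (zonal (w : Amb m) n)‖ ^ 2 = 0 := by exact_mod_cast h
      simpa using this
    have h2 := congrFun (polyL2_eq_iff.1 h1) w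
    rw [restrictSph_apply, evalAt_zonal (hzw w), real_inner_self_eq_norm_sq, hzw w, one_pow,
      legendreP_one hm1] at h2
    simp at h2
  set b := stdOrthonormalBasis ℂ (harmL2 m n) with hb
  have hY : ∀ j, ∃ Y ∈ harmPoly m n, polyL2 m Y = b j := fun j => (b j).2
  choose Y hYm hYb using hY
  have hsum : ∀ w : Sph m, ∑ j, evalAt (w : Amb m) (conjPoly (Y j) * Y j) = k⁻¹ := by
    intro w
    have h1 := b.sum_inner_mul_inner ⟨_, hZ w⟩ ⟨_, hZ w⟩
    have h2 : ∀ j, inner ℂ (polyL2 m (zonal (w : Amb m) n)) (b j : L2Sph m) =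
        k * evalAt (w : Amb m) (Y j) := by
      intro j
      rw [← hYb, inner_polyL2_zonal, hk _ (hzw w) _ (hYm j)]
    have hkr : starRingEnd ℂ k = k := by rw [← hself w, Complex.conj_ofReal]
    have h3 : ∀ j, inner ℂ (b j : L2Sph m) (polyL2 m (zonal (w : Amb m) n)) =
        k * evalAt (w : Amb m) (conjPoly (Y j)) := by
      intro j
      rw [← inner_conj_symm, h2, map_mul, hkr, evalAt_conjPoly]
    simp only [Submodule.coe_inner, h2, h3] at h1
    rw [inner_self_eq_norm_sq_to_K] at h1
    have h4 := hself w
    push_cast at h4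
    replace h1 := h1.trans h4
    have h5 : k * (k * ∑ j, evalAt (w : Amb m) (conjPoly (Y j) * Y j)) = k := by
      rw [← mul_assoc, Finset.mul_sum]
      refine Eq.trans (Finset.sum_congr rfl fun j _ => ?_) h1
      rw [map_mul]; ring
    exact eq_inv_of_mul_eq_one_right (mul_left_cancel₀ hk0 (by rw [h5, mul_one]))
  have hint : (dimHarm m n : ℂ) = (surf m).real Set.univ * k⁻¹ := by
    have h1 : ∑ j, sphInt (conjPoly (Y j) * Y j) = (dimHarm m n : ℂ) := by
      have : ∀ j, sphInt (conjPoly (Y j) * Y j) = 1 := by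
        intro j
        rw [← inner_polyL2, hYb, ← Submodule.coe_inner, b.inner_eq_one]
      simp [this, finrank_harmL2]
    rw [← h1]
    unfold sphInt
    rw [← integral_finsetSum _ fun j _ => integrable_evalAt _]
    simp only [hsum]
    rw [integral_const]
    simp
  have hS : (surf m).real Set.univ ≠ 0 := by
    have : NeZero (surf m) := ⟨Measure.toSphere_ne_zero _⟩
    exact measureReal_univ_pos.ne'
  have hSC : (((surf m).real Set.univ : ℝ) : ℂ) ≠ 0 := by exact_mod_cast hS
  have hd : (dimHarm m n : ℂ) ≠ 0 := by
    rw [hint]; exact mul_ne_zero hSC (inv_ne_zero hk0)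
  refine ⟨Nat.pos_of_ne_zero (by exact_mod_cast hd), fun w hw Y hY => ?_⟩
  rw [hk w hw Y hY]
  congr 1
  push_cast
  rw [hint]
  field_simp

/-! ### Dimensions of the spaces of spherical harmonics -/

/-- A crude bound: the exponents of the monomials of degree `n` lie in `{0, …, n}`. -/
theorem dimHarm_le (m n : ℕ) : dimHarm m n ≤ (n + 1) ^ (m + 1) := by
  classical
  set F : (Fin (m + 1) → Fin (n + 1)) → (Sph m → ℂ) := fun d =>
    restrictSph m (monomial (Finsupp.equivFunOnFinite.symm fun i => (d i : ℕ)) 1) with hF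
  have hle : sphericalHarmonics m n ≤ Submodule.span ℂ (Set.range F) := by
    rw [sphericalHarmonics_eq]
    rintro _ ⟨p, hp, rfl⟩
    rw [p.as_sum, map_sum]
    refine Submodule.sum_mem _ fun d hd => ?_
    have hdeg : d.degree = n := by
      rw [Finsupp.degree_eq_weight_one]
      exact (mem_harmPoly.1 hp).1 (mem_support_iff.1 hd)
    rw [show (monomial d (coeff d p) : Poly m) = coeff d p • monomial d 1 by
      rw [smul_monomial, smul_eq_mul, mul_one], map_smul]
    refine Submodule.smul_mem _ _ (Submodule.subset_span
      ⟨fun i => ⟨d i, Nat.lt_succ_of_le (hdeg ▸ Finsupp.le_degree i d)⟩, ?_⟩)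
    simp only [hF]
    congr 2
    ext i
    simp
  have hfin : FiniteDimensional ℂ (Submodule.span ℂ (Set.range F)) :=
    FiniteDimensional.span_of_finite ℂ (Set.finite_range F)
  refine (Submodule.finrank_mono hle).trans ((finrank_range_le_card F).trans ?_)
  simp

theorem dimHarm_zero (hm : 2 ≤ m) : dimHarm m 0 = 1 := by
  have h1 := dimHarm_le m 0
  have h2 := (sphInt_zonal_mul hm 0).1
  simp at h1
  omega

/-- Polynomials in the first `m` coordinates, restricted to the sphere. -/
noncomputable def projPolyL2 (m : ℕ) : MvPolynomial (Fin m) ℂ →ₗ[ℂ] L2Sph m :=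
  polyL2 m ∘ₗ (rename Fin.castSucc : MvPolynomial (Fin m) ℂ →ₐ[ℂ] Poly m).toLinearMap

/-- The projection of the sphere to the first `m` coordinates has nonempty interior, so a
polynomial in these coordinates is determined by its values on the sphere. -/
theorem projPolyL2_injective (hm : 1 ≤ m) : Function.Injective (projPolyL2 m) := by
  rw [injective_iff_map_eq_zero]
  intro p hp
  have hm' : (1 : ℝ) ≤ m := by exact_mod_cast hm
  have h1 : restrictSph m (rename Fin.castSucc p) = 0 := by
    rw [← map_zero (restrictSph m)]
    refine polyL2_eq_iff.1 ?_
    rw [map_zero]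
    exact hp
  set s : Set ℂ := (fun r : ℝ => (r : ℂ)) '' Set.Icc 0 (1 / m) with hs
  have hsinf : s.Infinite :=
    (Set.Icc_infinite (by positivity)).image Complex.ofReal_injective.injOn
  refine MvPolynomial.funext_set (fun _ => s) (fun _ => hsinf) fun x hx => ?_
  choose y hy hyx using fun i => hx i (Set.mem_univ i)
  have hsum : ∑ i, y i ^ 2 ≤ 1 := by
    have : ∀ i, y i ^ 2 ≤ 1 / m := by
      intro i
      have h2 : (1 : ℝ) / m ≤ 1 := by rw [div_le_one (by linarith)]; exact hm'
      nlinarith [(hy i).1, (hy i).2]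
    calc ∑ i, y i ^ 2 ≤ ∑ _i : Fin m, (1 : ℝ) / m := Finset.sum_le_sum fun i _ => this i
      _ = 1 := by simp; field_simp
  set z : Amb m := WithLp.toLp 2 (Fin.snoc (α := fun _ => ℝ) y (√(1 - ∑ i, y i ^ 2))) with hz
  have hzn : ‖z‖ = 1 := by
    have : ‖z‖ ^ 2 = 1 := by
      rw [EuclideanSpace.real_norm_sq_eq, Fin.sum_univ_castSucc]
      simp only [hz, Fin.snoc_castSucc, Fin.snoc_last]
      rw [Real.sq_sqrt (by linarith)]
      ring
    nlinarith [norm_nonneg z]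
  have h2 := congrFun h1 ⟨z, mem_sphere_zero_iff_norm.2 hzn⟩
  rw [restrictSph_apply, evalAt, eval_rename] at h2
  have h3 : ((fun i => ((z i : ℝ) : ℂ)) ∘ Fin.castSucc) = x := by
    ext i
    simp [hz, ← hyx]
  rw [map_zero, ← h3]
  exact h2

/-- The number of eigenvalues that belong to degrees less than `n`, that is `d_0 + ⋯ + d_{n-1}`. -/
noncomputable def cumDim (m n : ℕ) : ℕ := ∑ j ∈ Finset.range n, dimHarm m j

/-- The monomials in the first `m` coordinates with all exponents at most `n / m` are linearly
independent on the sphere and have degree at most `n`. -/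
theorem pow_le_cumDim (hm : 2 ≤ m) (n : ℕ) : (n / m + 1) ^ m ≤ cumDim m (n + 1) := by
  classical
  set q := n / m with hq
  let e : (Fin m → Fin (q + 1)) → (Fin m →₀ ℕ) := fun d =>
    Finsupp.equivFunOnFinite.symm fun i => (d i : ℕ)
  have he : Function.Injective e := by
    intro d d' h
    ext i
    have := DFunLike.congr_fun h i
    simpa [e] using this
  have hli : LinearIndependent ℂ fun d => projPolyL2 m (monomial (e d) 1) := by
    have h1 := (basisMonomials (Fin m) ℂ).linearIndependent.comp e he
    have h2 := h1.map' (projPolyL2 m) (LinearMap.ker_eq_bot.2 (projPolyL2_injective (by omega)))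
    simpa only [Function.comp_def, coe_basisMonomials] using h2
  set W : Submodule ℂ (L2Sph m) := ⨆ j ∈ Finset.range (n + 1), harmL2 m j with hW
  have hWfin : FiniteDimensional ℂ W := finiteDimensional_biSup _
  have hmem : ∀ d, projPolyL2 m (monomial (e d) 1) ∈ W := by
    intro d
    refine polyL2_mem_biSup hm (Nat.lt_succ_of_le ?_)
    refine (totalDegree_rename_le _ _).trans ((totalDegree_monomial_le _ _).trans ?_)
    rw [Finsupp.sum_fintype _ _ fun _ => rfl]
    calc ∑ i, (e d) i ≤ ∑ _i : Fin m, q := Finset.sum_le_sum fun i _ => by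
            simpa [e] using Nat.lt_succ_iff.1 (d i).2
      _ = m * (n / m) := by simp [hq]
      _ ≤ n := Nat.mul_div_le n m
  have hli' : LinearIndependent ℂ fun d => (⟨_, hmem d⟩ : W) :=
    LinearIndependent.of_comp W.subtype hli
  have hcard := hli'.fintype_card_le_finrank
  rw [hW, finrank_iSup_of_orthogonal harmL2_orthogonal] at hcard
  simpa [finrank_harmL2, cumDim] using hcard

/-! ### The eigenvalue sequence -/

theorem cumDim_succ (m n : ℕ) : cumDim m (n + 1) = cumDim m n + dimHarm m n :=
  Finset.sum_range_succ _ _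

theorem cumDim_mono (m : ℕ) : Monotone (cumDim m) := by
  refine monotone_nat_of_le_succ fun n => ?_
  rw [cumDim_succ]; omega

theorem exists_le_cumDim (hm : 2 ≤ m) (k : ℕ) : ∃ n, k ≤ cumDim m (n + 1) := by
  refine ⟨m * k, le_trans ?_ (pow_le_cumDim hm (m * k))⟩
  rw [Nat.mul_div_cancel_left k (by omega)]
  exact (Nat.le_succ k).trans (Nat.le_self_pow (by omega) _)

open Classical in
/-- The degree of the spherical harmonics to which the `k`-th eigenvalue belongs, when the spaces of
spherical harmonics are listed by degree: the least `n` with `k ≤ d_0 + ⋯ + d_n`. Such an `n` exists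
for `m ≥ 2`; otherwise the value is `0`. -/
noncomputable def degreeIndex (m k : ℕ) : ℕ :=
  if h : ∃ n, k ≤ cumDim m (n + 1) then Nat.find h else 0

theorem le_cumDim_degreeIndex (hm : 2 ≤ m) (k : ℕ) : k ≤ cumDim m (degreeIndex m k + 1) := by
  classical
  have h := exists_le_cumDim hm k
  rw [degreeIndex, dif_pos h]
  exact Nat.find_spec h

theorem degreeIndex_le (hm : 2 ≤ m) {k n : ℕ} (hk : k ≤ cumDim m (n + 1)) : degreeIndex m k ≤ n := by
  classical
  rw [degreeIndex, dif_pos (exists_le_cumDim hm k)]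
  exact Nat.find_min' _ hk

theorem degreeIndex_eq_iff (hm : 2 ≤ m) {k : ℕ} (hk : 0 < k) (n : ℕ) :
    degreeIndex m k = n ↔ k ∈ Set.Ioc (cumDim m n) (cumDim m (n + 1)) := by
  have h1 := le_cumDim_degreeIndex hm k
  have h2 : cumDim m (degreeIndex m k) < k := by
    by_contra! h
    rcases Nat.eq_zero_or_pos (degreeIndex m k) with h0 | h0
    · rw [h0] at h
      simp only [cumDim, Finset.range_zero, Finset.sum_empty] at h
      omega
    · have h3 := degreeIndex_le hm (k := k) (n := degreeIndex m k - 1)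
        (by rwa [Nat.sub_add_cancel h0])
      omega
  constructor
  · rintro rfl
    exact ⟨h2, h1⟩
  · rintro ⟨h3, h4⟩
    refine le_antisymm (degreeIndex_le hm h4) ?_
    by_contra! h
    exact absurd (h1.trans (cumDim_mono m h)) (by omega)

theorem degreeIndex_mono (hm : 2 ≤ m) : Monotone (degreeIndex m) := fun _ k hjk =>
  degreeIndex_le hm (hjk.trans (le_cumDim_degreeIndex hm k))

theorem encard_degreeIndex_eq (hm : 2 ≤ m) (n : ℕ) :
    {k : ℕ+ | degreeIndex m k = n}.encard = (dimHarm m n : ℕ∞) := by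
  have h1 : {k : ℕ+ | degreeIndex m k = n} =
      (fun k : ℕ+ => (k : ℕ)) ⁻¹' (Finset.Ioc (cumDim m n) (cumDim m (n + 1)) : Finset ℕ) := by
    ext k
    rw [Set.mem_ofPred_eq, degreeIndex_eq_iff hm k.pos, Set.mem_preimage, Finset.coe_Ioc]
  rw [h1, Set.encard_preimage_of_injective_subset_range PNat.coe_injective,
    Set.encard_coe_eq_coe_finsetCard, Nat.card_Ioc, cumDim_succ]
  · simp
  · intro k hk
    rw [Finset.coe_Ioc] at hk
    exact ⟨⟨k, by have := hk.1; omega⟩, rfl⟩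

theorem encard_degreeIndex_mem (hm : 2 ≤ m) (I : Finset ℕ) :
    {k : ℕ+ | degreeIndex m k ∈ I}.encard = ((∑ n ∈ I, dimHarm m n : ℕ) : ℕ∞) := by
  classical
  induction I using Finset.induction_on with
  | empty => simp
  | insert a s ha ih =>
    have h : {k : ℕ+ | degreeIndex m k ∈ insert a s} =
        {k : ℕ+ | degreeIndex m k = a} ∪ {k : ℕ+ | degreeIndex m k ∈ s} := by
      ext k; simp
    rw [h, Set.encard_union_eq, encard_degreeIndex_eq hm, ih, Finset.sum_insert ha]
    · push_cast; rfl
    · rw [Set.disjoint_left]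
      rintro k (hk : _ = a) (hk' : _ ∈ s)
      exact ha (hk ▸ hk')

/-- The denominators `n^(2n+m-1)`, with the value `1` for `n = 0`. -/
noncomputable def denom (m n : ℕ) : ℝ := ((max n 1 : ℕ) : ℝ) ^ (2 * n + m - 1)

theorem one_le_denom (m n : ℕ) : 1 ≤ denom m n :=
  one_le_pow₀ (by exact_mod_cast le_max_right n 1)

theorem denom_pos (m n : ℕ) : 0 < denom m n := one_pos.trans_le (one_le_denom m n)

theorem denom_mono (m : ℕ) : Monotone (denom m) := by
  intro a b hab
  have h1 : ((max a 1 : ℕ) : ℝ) ≤ ((max b 1 : ℕ) : ℝ) := by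
    exact_mod_cast max_le_max hab le_rfl
  have h2 : (1 : ℝ) ≤ ((max b 1 : ℕ) : ℝ) := by exact_mod_cast le_max_right b 1
  exact (pow_le_pow_left₀ (by positivity) h1 _).trans (pow_le_pow_right₀ h2 (by omega))

theorem natCast_le_denom (hm : 1 ≤ m) (n : ℕ) : (n : ℝ) ≤ denom m n := by
  rcases Nat.eq_zero_or_pos n with rfl | hn
  · simpa using (denom_pos m 0).le
  · have h : (1 : ℝ) ≤ ((max n 1 : ℕ) : ℝ) := by exact_mod_cast le_max_right n 1
    calc (n : ℝ) ≤ ((max n 1 : ℕ) : ℝ) := by exact_mod_cast le_max_left n 1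
      _ ≤ _ := le_self_pow₀ h (by omega)

theorem factorial_le_denom (hm : 1 ≤ m) (n : ℕ) : (n.factorial : ℝ) ≤ denom m n := by
  have h : (1 : ℝ) ≤ ((max n 1 : ℕ) : ℝ) := by exact_mod_cast le_max_right n 1
  calc (n.factorial : ℝ) ≤ (n : ℝ) ^ n := by exact_mod_cast Nat.factorial_le_pow n
    _ ≤ ((max n 1 : ℕ) : ℝ) ^ n := by
      gcongr
      exact le_max_left n 1
    _ ≤ _ := pow_le_pow_right₀ h (by omega)

/-- The coefficients of the kernel; the value at `n = 0` is `d_0 = 1`. -/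
noncomputable def kernelCoeff (m n : ℕ) : ℝ := dimHarm m n / denom m n

theorem rapidDecay_kernelCoeff (hm : 1 ≤ m) : RapidDecay (kernelCoeff m) := by
  intro R hR
  have hs := (Real.summable_pow_div_factorial (Real.exp 1 * R)).mul_left
    ((m + 1).factorial * Real.exp 1)
  refine Summable.of_nonneg_of_le (fun n => by positivity) (fun n => ?_) hs
  have h1 : (dimHarm m n : ℝ) ≤ (m + 1).factorial * Real.exp (n + 1) := by
    have h2 : (dimHarm m n : ℝ) ≤ ((n : ℝ) + 1) ^ (m + 1) := by exact_mod_cast dimHarm_le m n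
    have h3 := Real.pow_div_factorial_le_exp ((n : ℝ) + 1) (by positivity) (m + 1)
    rw [div_le_iff₀ (by positivity)] at h3
    linarith
  have h4 : |kernelCoeff m n| ≤ (m + 1).factorial * Real.exp (n + 1) / n.factorial := by
    unfold kernelCoeff
    rw [abs_of_nonneg (div_nonneg (by positivity) (denom_pos m n).le)]
    exact div_le_div₀ (by positivity) h1 (by positivity) (factorial_le_denom hm n)
  calc _ ≤ (m + 1).factorial * Real.exp (n + 1) / n.factorial * R ^ n := by gcongr
    _ = _ := by
      rw [Real.exp_add, mul_pow, ← Real.exp_nat_mul, mul_one]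
      ring

/-- The eigenvalue of the integral operator on spherical harmonics of degree `n`. -/
noncomputable def kernelEigenvalue (m n : ℕ) : ℝ := (surf m).real Set.univ / denom m n

theorem surf_real_univ_pos (m : ℕ) : 0 < (surf m).real Set.univ := by
  have : NeZero (surf m) := ⟨Measure.toSphere_ne_zero _⟩
  exact measureReal_univ_pos

theorem kernelEigenvalue_pos (m n : ℕ) : 0 < kernelEigenvalue m n :=
  div_pos (surf_real_univ_pos m) (denom_pos m n)

theorem kernelEigenvalue_antitone (m : ℕ) : Antitone (kernelEigenvalue m) := fun a _ hab =>
  div_le_div_of_nonneg_left (surf_real_univ_pos m).le (denom_pos m a) (denom_mono m hab)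

theorem exists_finset_kernelEigenvalue (hm : 1 ≤ m) {μ : ℝ} (hμ : 0 < μ) :
    ∃ I : Finset ℕ, ∀ n, n ∈ I ↔ kernelEigenvalue m n = μ := by
  have hfin : {n | kernelEigenvalue m n = μ}.Finite := by
    refine (Set.finite_Iic ⌈(surf m).real Set.univ / μ⌉₊).subset fun n (hn : _ = _) => ?_
    have h1 := natCast_le_denom hm n
    have h2 : (n : ℝ) ≤ (surf m).real Set.univ / μ := by
      rw [le_div_iff₀ hμ, ← hn, kernelEigenvalue, mul_div_assoc', div_le_iff₀ (denom_pos m n),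
        mul_comm]
      exact mul_le_mul_of_nonneg_left h1 (surf_real_univ_pos m).le
    exact_mod_cast h2.trans (Nat.le_ceil _)
  exact ⟨hfin.toFinset, fun n => by simp⟩

theorem integral_zonalKernel_mul (hm : 2 ≤ m) {n : ℕ} {Y : Poly m} (hY : Y ∈ harmPoly m n)
    (x : Sph m) :
    ∫ y, zonalKernel (kernelCoeff m) x y * evalAt (y : Amb m) Y ∂(surf m) =
      kernelEigenvalue m n * evalAt (x : Amb m) Y := by
  have hm1 : 1 ≤ m := by omega
  have hx : ‖(x : Amb m)‖ = 1 := norm_eq_of_mem_sphere x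
  have ha := rapidDecay_kernelCoeff hm1
  have hYc : Continuous fun y : Sph m => evalAt (y : Amb m) Y :=
    (continuous_evalAt Y).comp continuous_subtype_val
  obtain ⟨C, hC⟩ := isCompact_univ.exists_bound_of_continuousOn hYc.continuousOn
  have hPc : ∀ k, Continuous fun y : Sph m => legendreKernel k x y := fun k =>
    (continuous_legendreKernel k).comp (Continuous.prodMk_right x)
  have h := hasSum_integral_of_dominated_convergence (μ := surf m)
    (F := fun k (y : Sph m) => (kernelCoeff m k : ℂ) * legendreKernel k x y * evalAt (y : Amb m) Y)
    (f := fun y => zonalKernel (kernelCoeff m) x y * evalAt (y : Amb m) Y)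
    (fun k _ => |kernelCoeff m k| * 3 ^ k * C)
    (fun k => (((hPc k).const_mul _).mul hYc).aestronglyMeasurable)
    (fun k => Eventually.of_forall fun y => by
      rw [norm_mul]
      exact mul_le_mul (norm_zonalKernel_term_le hm1 _ k x y) (hC y (Set.mem_univ y))
        (norm_nonneg _) (by positivity))
    (Eventually.of_forall fun y => (ha 3 (by norm_num)).mul_right C) (integrable_const _)
    (Eventually.of_forall fun y => (hasSum_zonalKernel hm1 ha x y).mul_right _)
  have hterm : ∀ k, ∫ y : Sph m, (kernelCoeff m k : ℂ) * legendreKernel k x y *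
      evalAt (y : Amb m) Y ∂(surf m) = kernelCoeff m k * sphInt (zonal (x : Amb m) k * Y) := by
    intro k
    simp only [mul_assoc]
    rw [integral_const_mul]
    unfold sphInt
    simp only [legendreKernel_eq_restrictSph, restrictSph_apply, map_mul]
  simp only [hterm] at h
  have h2 := hasSum_single (f := fun k => (kernelCoeff m k : ℂ) * sphInt (zonal (x : Amb m) k * Y)) n
    fun k hk => by rw [sphInt_mul_eq_zero hk (zonal_mem_harmPoly hm1 hx k) hY, mul_zero]
  rw [h.unique h2, (sphInt_zonal_mul hm n).2 _ hx _ hY, ← mul_assoc, ← Complex.ofReal_mul]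
  congr 2
  have hd : (dimHarm m n : ℝ) ≠ 0 := by exact_mod_cast (sphInt_zonal_mul hm n).1.ne'
  have := (denom_pos m n).ne'
  unfold kernelCoeff kernelEigenvalue
  field_simp

theorem isDiagonal_of_isIntegralOperator (hm : 2 ≤ m) {T : L2Sph m →L[ℂ] L2Sph m}
    (hT : IsIntegralOperator (zonalKernel (kernelCoeff m)) T) :
    IsDiagonal (harmL2 m) T (kernelEigenvalue m) where
  orthogonal := harmL2_orthogonal
  total := harmL2_total hm
  nonneg n := (kernelEigenvalue_pos m n).le
  apply_eq := by
    rintro n _ ⟨Y, hY, rfl⟩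
    refine Lp.ext ?_
    filter_upwards [hT (polyL2 m Y), polyL2_coeFn Y,
      Lp.coeFn_smul (kernelEigenvalue m n : ℂ) (polyL2 m Y)] with x h1 h2 h3
    rw [h1.2, h3, Pi.smul_apply, h2, smul_eq_mul, ← integral_zonalKernel_mul hm hY]
    refine integral_congr_ae ?_
    filter_upwards [polyL2_coeFn Y] with y hy
    rw [hy]

theorem isEigenvalueSequence (hm : 2 ≤ m) {T : L2Sph m →L[ℂ] L2Sph m}
    (hT : IsIntegralOperator (zonalKernel (kernelCoeff m)) T) :
    IsEigenvalueSequence T fun k => kernelEigenvalue m (degreeIndex m k) := by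
  have hdiag := isDiagonal_of_isIntegralOperator hm hT
  refine ⟨fun j k hjk => kernelEigenvalue_antitone m (degreeIndex_mono hm (by exact_mod_cast hjk)),
    fun k => (kernelEigenvalue_pos m _).le, fun μ hμ => ?_, fun μ hμ => ?_⟩ <;>
  obtain ⟨I, hI⟩ := exists_finset_kernelEigenvalue (m := m) (by omega) hμ
  · rw [hdiag.eigenspace_eq μ I hI]
    exact finiteDimensional_biSup I
  · rw [hdiag.eigenspace_eq μ I hI, finrank_iSup_of_orthogonal harmL2_orthogonal]
    simp only [finrank_harmL2]
    rw [← encard_degreeIndex_mem hm I]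
    simp only [hI]

theorem isSmoothPDKernel (hm : 2 ≤ m) :
    IsSmoothPDKernel (zonalKernel (kernelCoeff m) : Sph m → Sph m → ℂ) where
  l2pd := by
    have hc := continuous_zonalKernel (m := m) (by omega) (rapidDecay_kernelCoeff (m := m) (by omega))
    obtain ⟨T, hT⟩ := exists_isIntegralOperator hc
    exact ⟨memLp_of_continuous hc, T, hT, (isDiagonal_of_isIntegralOperator hm hT).isPositive⟩
  smooth := Eventually.of_forall fun x r =>
    ⟨_, isLBDerivOfOrder_zonalKernel (by omega) (rapidDecay_kernelCoeff (by omega)) x r⟩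
  bounded r := by
    have hm1 : 1 ≤ m := by omega
    have ha := rapidDecay_kernelCoeff hm1
    have hc := continuous_zonalKernel (m := m) hm1
      (ha.mul_pow (by norm_num) (abs_lbEigenvalue_le hm1) r)
    exact ⟨_, ⟨hc.aestronglyMeasurable, Eventually.of_forall fun x =>
      isLBDerivOfOrder_zonalKernel hm1 ha x r⟩, exists_isIntegralOperator hc⟩

theorem hasSum_pnat_zonalKernel (hm : 2 ≤ m) (x y : Sph m) : HasSum
    (fun n : ℕ+ => (((dimHarm m n : ℝ) / (n : ℝ) ^ (2 * (n : ℕ) + m - 1) *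
      legendreP m n (inner ℝ (x : EuclideanSpace ℝ (Fin (m + 1)))
        (y : EuclideanSpace ℝ (Fin (m + 1)))) : ℝ) : ℂ))
    (zonalKernel (kernelCoeff m) x y - 1) := by
  have hm1 : 1 ≤ m := by omega
  have h := hasSum_zonalKernel hm1 (rapidDecay_kernelCoeff hm1) x y
  have h1 := (hasSum_nat_add_iff' 1).2 h
  have h0 : (kernelCoeff m 0 : ℂ) * legendreKernel 0 x y = 1 := by
    simp [kernelCoeff, dimHarm_zero hm, denom, legendreKernel, legendreP]
  rw [Finset.sum_range_one, h0] at h1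
  have h2 := Equiv.pnatEquivNat.hasSum_iff.2 h1
  refine cast (congrArg (fun f => HasSum f _) (_root_.funext fun n => ?_)) h2
  have hn : PNat.natPred n + 1 = n := PNat.natPred_add_one n
  have hmax : max (n : ℕ) 1 = n := max_eq_left n.pos
  simp only [Function.comp_apply, Equiv.pnatEquivNat_apply, hn, kernelCoeff, denom, legendreKernel,
    hmax]
  push_cast
  rfl

/-! ### Growth of the weights -/

/-- The degree attached to the `k`-th eigenvalue is `O(k^(1/m))`, since there are at least
`(n / m)^m` eigenvalues of degree less than `n`. -/
theorem degreeIndex_le_rpow (hm : 2 ≤ m) {k : ℕ} (hk : 0 < k) :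
    (degreeIndex m k : ℝ) ≤ m * (k : ℝ) ^ (1 / (m : ℝ)) := by
  have hm0 : (0 : ℝ) < m := by exact_mod_cast (by omega : 0 < m)
  rcases Nat.eq_zero_or_pos (degreeIndex m k) with h0 | h0
  · rw [h0]; simp only [Nat.cast_zero]; positivity
  obtain ⟨n, hn⟩ := Nat.exists_eq_succ_of_ne_zero h0.ne'
  have h1 := ((degreeIndex_eq_iff hm hk _).1 hn).1
  have h2 : ((n / m + 1 : ℕ) : ℝ) ^ m ≤ k := by
    exact_mod_cast (pow_le_cumDim hm n).trans h1.le
  have h3 : ((n / m + 1 : ℕ) : ℝ) ≤ (k : ℝ) ^ (1 / (m : ℝ)) := by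
    rw [one_div]
    refine (Real.le_rpow_inv_iff_of_pos (by positivity) (by positivity) hm0).2 ?_
    rwa [Real.rpow_natCast]
  have h4 : n + 1 ≤ m * (n / m + 1) := by
    have := Nat.lt_mul_div_succ n (show 0 < m by omega)
    omega
  rw [hn]
  calc ((n.succ : ℕ) : ℝ) ≤ ((m * (n / m + 1) : ℕ) : ℝ) := by exact_mod_cast h4
    _ = m * ((n / m + 1 : ℕ) : ℝ) := by push_cast; ring
    _ ≤ _ := by gcongr

/-- For `k ≥ m` the degree `n` of the `k`-th eigenvalue is at most `k²`, and
`2 n + m - 1 ≤ (m + 1) n ≤ (m + 1) m k^(1/m)`. -/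
theorem denom_degreeIndex_le (hm : 2 ≤ m) {k : ℕ} (hk : m ≤ k) :
    denom m (degreeIndex m k) ≤ (k : ℝ) ^ (2 * m * (m + 1) * (k : ℝ) ^ (1 / (m : ℝ))) := by
  have hk0 : 0 < k := by omega
  have hm0 : (0 : ℝ) < m := by exact_mod_cast (by omega : 0 < m)
  have hk1 : (1 : ℝ) ≤ k := by exact_mod_cast hk0
  have hmk : (m : ℝ) ≤ k := by exact_mod_cast hk
  set n := degreeIndex m k with hn
  have h1 := degreeIndex_le_rpow hm hk0
  rw [← hn] at h1
  rcases Nat.eq_zero_or_pos n with h0 | h0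
  · rw [h0]
    simp only [denom, zero_le, max_eq_right, Nat.cast_one, one_pow]
    exact Real.one_le_rpow hk1 (by positivity)
  have h2 : (k : ℝ) ^ (1 / (m : ℝ)) ≤ k := by
    calc (k : ℝ) ^ (1 / (m : ℝ)) ≤ (k : ℝ) ^ (1 : ℝ) := by
          refine Real.rpow_le_rpow_of_exponent_le hk1 ?_
          rw [div_le_one hm0]
          exact_mod_cast (by omega : 1 ≤ m)
      _ = k := Real.rpow_one _
  have h3 : (n : ℝ) ≤ (k : ℝ) ^ 2 := by
    calc (n : ℝ) ≤ m * (k : ℝ) ^ (1 / (m : ℝ)) := h1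
      _ ≤ k * k := by gcongr
      _ = _ := by ring
  have h4 : ((2 * (2 * n + m - 1) : ℕ) : ℝ) ≤ 2 * m * (m + 1) * (k : ℝ) ^ (1 / (m : ℝ)) := by
    have h5 : 2 * n + m - 1 ≤ (m + 1) * n := by
      obtain ⟨j, hj⟩ := Nat.exists_eq_succ_of_ne_zero h0.ne'
      rw [hj]
      have : (m + 1) * (j + 1) = m * j + m + j + 1 := by ring
      have h6 : 2 * j ≤ m * j := Nat.mul_le_mul_right j hm
      simp only [Nat.succ_eq_add_one]
      omega
    calc ((2 * (2 * n + m - 1) : ℕ) : ℝ) ≤ ((2 * ((m + 1) * n) : ℕ) : ℝ) := by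
          exact_mod_cast Nat.mul_le_mul_left 2 h5
      _ = 2 * (m + 1) * n := by push_cast; ring
      _ ≤ 2 * (m + 1) * (m * (k : ℝ) ^ (1 / (m : ℝ))) := by gcongr
      _ = _ := by ring
  calc denom m n = (n : ℝ) ^ (2 * n + m - 1) := by rw [denom, max_eq_left h0]
    _ ≤ ((k : ℝ) ^ 2) ^ (2 * n + m - 1) := by gcongr
    _ = (k : ℝ) ^ ((2 * (2 * n + m - 1) : ℕ) : ℝ) := by rw [← pow_mul, Real.rpow_natCast]
    _ ≤ _ := Real.rpow_le_rpow_of_exponent_le hk1 h4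

theorem delta_pos (m : ℕ) : 0 < delta m := by
  unfold delta
  split_ifs <;> norm_num

end SphericalKernels

open SphericalKernels
theorem theorem5p1 (m : ℕ) (hm : 2 ≤ m) :
    ∃ (β : ℕ+ → ℝ) (K : Sph m → Sph m → ℂ) (T : L2Sph m →L[ℂ] L2Sph m) (lam : ℕ+ → ℝ),
      (∀ n, 0 < β n) ∧
      β =O[atTop] (fun n : ℕ+ => (n : ℝ) ^ (1 / (m : ℝ))) ∧
      (∀ x y : Sph m, HasSum
        (fun n : ℕ+ => (((dimHarm m n : ℝ) / (n : ℝ) ^ (2 * (n : ℕ) + m - 1) *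
          legendreP m n (inner ℝ (x : EuclideanSpace ℝ (Fin (m + 1)))
            (y : EuclideanSpace ℝ (Fin (m + 1)))) : ℝ) : ℂ))
        (K x y - 1)) ∧
      IsSmoothPDKernel K ∧
      IsIntegralOperator K T ∧
      IsEigenvalueSequence T lam ∧
      ¬ Summable (fun n : ℕ+ =>
        (n : ℝ) ^ ((n : ℝ) ^ (1 / (m : ℝ)) / (delta m * m) + β n) * lam n) := by
  have hm0 : (0 : ℝ) < m := by exact_mod_cast (by omega : 0 < m)
  obtain ⟨T, hT⟩ := exists_isIntegralOperator
    (continuous_zonalKernel (m := m) (by omega) (rapidDecay_kernelCoeff (m := m) (by omega)))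
  have hpos : ∀ n : ℕ+, (0 : ℝ) < (n : ℝ) ^ (1 / (m : ℝ)) := fun n =>
    Real.rpow_pos_of_pos (by exact_mod_cast n.pos) _
  refine ⟨fun n => 2 * m * (m + 1) * (n : ℝ) ^ (1 / (m : ℝ)), zonalKernel (kernelCoeff m), T,
    fun k => kernelEigenvalue m (degreeIndex m k), fun n => ?_, ?_, hasSum_pnat_zonalKernel hm,
    isSmoothPDKernel hm, hT, isEigenvalueSequence hm hT, fun hsum => ?_⟩
  · have := hpos n
    positivity
  · exact isBigO_const_mul_self _ _ _
  -- `λ_k` is the surface area over a denominator that `k^{β_k}` outweighs as soon as `k ≥ m`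
  have hlarge : ∀ n : ℕ+, m ≤ (n : ℕ) → (surf m).real Set.univ ≤
      (n : ℝ) ^ ((n : ℝ) ^ (1 / (m : ℝ)) / (delta m * m) + 2 * m * (m + 1) *
        (n : ℝ) ^ (1 / (m : ℝ))) * kernelEigenvalue m (degreeIndex m n) := by
    intro n hn
    have hn1 : (1 : ℝ) ≤ n := by exact_mod_cast n.pos
    have h1 := denom_degreeIndex_le hm hn
    have h2 : (n : ℝ) ^ (2 * m * (m + 1) * (n : ℝ) ^ (1 / (m : ℝ))) ≤
        (n : ℝ) ^ ((n : ℝ) ^ (1 / (m : ℝ)) / (delta m * m) + 2 * m * (m + 1) *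
          (n : ℝ) ^ (1 / (m : ℝ))) := by
      refine Real.rpow_le_rpow_of_exponent_le hn1 (le_add_of_nonneg_left ?_)
      exact div_nonneg (hpos n).le (mul_pos (delta_pos m) hm0).le
    rw [kernelEigenvalue, mul_div_assoc', le_div_iff₀ (denom_pos _ _), mul_comm]
    exact mul_le_mul_of_nonneg_right (h1.trans h2) (surf_real_univ_pos m).le
  have hev := hsum.tendsto_cofinite_zero.eventually_lt_const (surf_real_univ_pos m)
  rw [eventually_cofinite] at hev
  refine (Set.Ici_infinite (α := ℕ+) ⟨m, by omega⟩).mono (fun n hn => ?_) hev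
  exact not_lt.2 (hlarge n hn)
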